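/- Theorem 3.3. Let $n\ge 0$. Let $\varphi_t(x,\xi)=(\cos t\,x+\sin t\,\xi,\,-\sin t\,x+\cos t\,\xi)$ be the flow on $\mathbb R^{2n}$ of the classical harmonic oscillator $h_0(x,\xi)=\tfrac12(\|x\|^2+\|\xi\|^2)$; for $T\in S'(\mathbb R^{2n})$ put $(\varphi_t^*T)(g)=T(g\circ\varphi_t)$, $g\in S(\mathbb R^{2n})$, and call $T$ a tempered constant of motion if $\varphi_t^*T=T$ for all $t\in\mathbb R$. Let $H_0=\tfrac12(-\Delta+\|x\|^2)$ be the quantum harmonic oscillator on $L^2(\mathbb R^n)$, with domain the set of all $u\in L^2(\mathbb R^n)$ with $-\Delta u+\|x\|^2u\in L^2(\mathbb R^n)$ in the sense of distributions. For $f\in S'(\mathbb R^{2n})$ let the Weyl quantization $\mathfrak{Op}(f):S(\mathbb R^n)\to S'(\mathbb R^n)$ be the continuous operator $$(\mathfrak{Op}(f)u)(v)=f\Big((q,\xi)\mapsto\int_{\mathbb R^n}e^{ip\cdot\xi}\,v\big(q+\tfrac p2\big)\,u\big(q-\tfrac p2\big)\,dp\Big),\qquad u,v\in S(\mathbb R^n),$$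 that is, the operator with kernel $K_f(x,y)=\int f\big(\tfrac{x+y}2,\xi\big)e^{i(x-y)\cdot\xi}\,d\xi$. Then $iH_0$ is the generator of exactly one strongly continuous one-parameter unitary group $e^{itH_0}$ on $L^2(\mathbb R^n)$; for each $t$, $e^{itH_0}$ maps $S(\mathbb R^n)$ continuously into itself and extends to a (weak-$*$) continuous linear operator on $S'(\mathbb R^n)$, denoted by the same symbol. For every tempered constant of motion $f\in S'(\mathbb R^{2n})$ and every $t\in\mathbb R$, $$e^{itH_0}\,\mathfrak{Op}(f)\,e^{-itH_0}=\mathfrak{Op}(f)$$ as operators from $S(\mathbb R^n)$ to $S'(\mathbb R^n)$. In particular $[H_0,\mathfrak{Op}(f)]=0$ on $S(\mathbb R^n)$, that is, $H_0\,\mathfrak{Op}(f)u=\mathfrak{Op}(f)\,H_0u$ in $S'(\mathbb R^n)$ for all $u\in S(\mathbb R^n)$, where $H_0$ acts on $S(\mathbb R^n)$ and $S'(\mathbb R^n)$ as the differential operator $\tfrac12(-\Delta+\|x\|^2)$. -/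

import Mathlib

open SchwartzMap MeasureTheory Filter Topology
open scoped ContDiff Laplacian

noncomputable section

namespace HarmonicWeyl

/-- The configuration space `ℝⁿ` with its Euclidean norm. -/
abbrev Config (n : ℕ) : Type := EuclideanSpace ℝ (Fin n)

/-- The phase space `ℝ²ⁿ = ℝⁿ × ℝⁿ`, with points `(x, ξ)`. -/
abbrev Phase (n : ℕ) : Type := Config n × Config n

/-- The complex Hilbert space `L²(ℝⁿ)`. -/
abbrev L2 (n : ℕ) : Type := Lp ℂ 2 (volume : Measure (Config n))

/-! ### The classical harmonic oscillator -/

/-- The flow `φ_t (x, ξ) = (cos t · x + sin t · ξ, - sin t · x + cos t · ξ)` of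
`h₀(x, ξ) = (‖x‖² + ‖ξ‖²) / 2`, as a linear automorphism of phase space. -/
def flow (n : ℕ) (t : ℝ) : Phase n ≃L[ℝ] Phase n :=
  ContinuousLinearEquiv.equivOfInverse
    ((Real.cos t • ContinuousLinearMap.fst ℝ (Config n) (Config n)
        + Real.sin t • ContinuousLinearMap.snd ℝ (Config n) (Config n)).prod
      (-Real.sin t • ContinuousLinearMap.fst ℝ (Config n) (Config n)
        + Real.cos t • ContinuousLinearMap.snd ℝ (Config n) (Config n)))
    ((Real.cos t • ContinuousLinearMap.fst ℝ (Config n) (Config n)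
        - Real.sin t • ContinuousLinearMap.snd ℝ (Config n) (Config n)).prod
      (Real.sin t • ContinuousLinearMap.fst ℝ (Config n) (Config n)
        + Real.cos t • ContinuousLinearMap.snd ℝ (Config n) (Config n)))
    (by
      rintro ⟨x, ξ⟩
      have h := Real.cos_sq_add_sin_sq t
      ext i
      · simp; linear_combination (x i) * h
      · simp; linear_combination (ξ i) * h)
    (by
      rintro ⟨x, ξ⟩
      have h := Real.cos_sq_add_sin_sq t
      ext i
      · simp; linear_combination (x i) * h
      · simp; linear_combination (ξ i) * h)

theorem flow_apply (n : ℕ) (t : ℝ) (x ξ : Config n) :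
    flow n t (x, ξ) = (Real.cos t • x + Real.sin t • ξ, -Real.sin t • x + Real.cos t • ξ) := rfl

/-- The pullback of tempered distributions: `(φ_t^* T)(g) = T (g ∘ φ_t)`. -/
def flowPullback (n : ℕ) (t : ℝ) (T : 𝓢'(Phase n, ℂ)) : 𝓢'(Phase n, ℂ) :=
  PointwiseConvergenceCLM.precomp ℂ (compCLMOfContinuousLinearEquiv ℂ (flow n t)) T

/-- Tempered constants of motion of the harmonic oscillator: `φ_t^* f = f` for all `t`. -/
def IsTemperedConstantOfMotion (n : ℕ) (f : 𝓢'(Phase n, ℂ)) : Prop :=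
  ∀ t : ℝ, flowPullback n t f = f

/-! ### The quantum harmonic oscillator -/

/-- The differential operator `(-Δ + ‖x‖²) / 2` on Schwartz functions. -/
def oscillatorSchwartz (n : ℕ) : 𝓢(Config n, ℂ) →L[ℂ] 𝓢(Config n, ℂ) :=
  (1 / 2 : ℂ) • (-LineDeriv.laplacianCLM ℂ (Config n) 𝓢(Config n, ℂ)
    + SchwartzMap.smulLeftCLM ℂ (fun x : Config n ↦ ((‖x‖ ^ 2 : ℝ) : ℂ)))

/-- The differential operator `(-Δ + ‖x‖²) / 2` on tempered distributions. -/
def oscillatorDistribution (n : ℕ) : 𝓢'(Config n, ℂ) →L[ℂ] 𝓢'(Config n, ℂ) :=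
  (1 / 2 : ℂ) • (-LineDeriv.laplacianCLM ℂ (Config n) 𝓢'(Config n, ℂ)
    + TemperedDistribution.smulLeftCLM ℂ (fun x : Config n ↦ ((‖x‖ ^ 2 : ℝ) : ℂ)))

theorem hasTemperateGrowth_normSq (n : ℕ) :
    (fun x : Config n ↦ ((‖x‖ ^ 2 : ℝ) : ℂ)).HasTemperateGrowth :=
  Function.HasTemperateGrowth.comp Function.Complex.hasTemperateGrowth_ofReal
    (Function.hasTemperateGrowth_norm_sq (Config n))

theorem oscillatorSchwartz_apply (n : ℕ) (φ : 𝓢(Config n, ℂ)) (x : Config n) :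
    oscillatorSchwartz n φ x = (1 / 2 : ℂ) * (-(Δ (φ : Config n → ℂ)) x + (‖x‖ ^ 2 : ℝ) * φ x) := by
  have h := smulLeftCLM_apply_apply (hasTemperateGrowth_normSq n) φ x
  rw [smul_eq_mul] at h
  rw [← h, ← SchwartzMap.laplacian_apply]
  simp [oscillatorSchwartz, mul_add]

theorem oscillatorDistribution_apply (n : ℕ) (T : 𝓢'(Config n, ℂ)) (φ : 𝓢(Config n, ℂ)) :
    oscillatorDistribution n T φ = T (oscillatorSchwartz n φ) := by
  simp [oscillatorDistribution, oscillatorSchwartz]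

/-- The graph of the harmonic oscillator: the pairs `(u, v)` in `L² × L²` such that
`(-Δ u + ‖x‖² u) / 2 = v` in the sense of distributions. -/
def oscillatorGraph (n : ℕ) : Submodule ℂ (L2 n × L2 n) :=
  LinearMap.eqLocus
    ((oscillatorDistribution n ∘L Lp.toTemperedDistributionCLM ℂ volume 2).toLinearMap ∘ₗ
      LinearMap.fst ℂ (L2 n) (L2 n))
    ((Lp.toTemperedDistributionCLM ℂ volume 2).toLinearMap ∘ₗ LinearMap.snd ℂ (L2 n) (L2 n))

/-- The quantum harmonic oscillator `H₀ = (-Δ + ‖x‖²) / 2` in `L²(ℝⁿ)`, with domain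
`{u ∈ L² : -Δ u + ‖x‖² u ∈ L²}`, derivatives being taken in the sense of distributions. -/
def harmonicOscillator (n : ℕ) : L2 n →ₗ.[ℂ] L2 n :=
  (oscillatorGraph n).toLinearPMap

theorem mem_graph_harmonicOscillator (n : ℕ) (u v : L2 n) :
    (u, v) ∈ (harmonicOscillator n).graph ↔
      oscillatorDistribution n (u : 𝓢'(Config n, ℂ)) = (v : 𝓢'(Config n, ℂ)) := by
  rw [harmonicOscillator, Submodule.toLinearPMap_graph_eq]
  · simp [oscillatorGraph, LinearMap.mem_eqLocus]
  · rintro ⟨u, v⟩ h (rfl : u = 0)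
    have hv : Lp.toTemperedDistributionCLM ℂ volume 2 v = 0 := by
      have h' : oscillatorDistribution n (Lp.toTemperedDistributionCLM ℂ volume 2 (0 : L2 n)) =
          Lp.toTemperedDistributionCLM ℂ volume 2 v := h
      rw [← h', _root_.map_zero, _root_.map_zero]
    have := Lp.ker_toTemperedDistributionCLM_eq_bot (F := ℂ)
      (μ := (volume : Measure (Config n))) (p := 2)
    exact (LinearMap.ker_eq_bot'.1 this) v hv

/-- On Schwartz functions, the two differential operators agree. -/
theorem oscillatorDistribution_coe (n : ℕ) (φ : 𝓢(Config n, ℂ)) :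
    oscillatorDistribution n (φ : 𝓢'(Config n, ℂ)) =
      (oscillatorSchwartz n φ : 𝓢'(Config n, ℂ)) := by
  have hg := hasTemperateGrowth_normSq n
  have h : TemperedDistribution.smulLeftCLM ℂ (fun x : Config n ↦ ((‖x‖ ^ 2 : ℝ) : ℂ))
      (φ : 𝓢'(Config n, ℂ)) =
      (SchwartzMap.smulLeftCLM ℂ (fun x : Config n ↦ ((‖x‖ ^ 2 : ℝ) : ℂ)) φ :
        𝓢'(Config n, ℂ)) := by
    ext ψ
    rw [TemperedDistribution.smulLeftCLM_apply_apply]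
    simp only [toTemperedDistributionCLM_apply_apply]
    congr 1 with x
    rw [smulLeftCLM_apply_apply hg, smulLeftCLM_apply_apply hg]
    simp only [smul_eq_mul]
    ring
  simp only [oscillatorDistribution, oscillatorSchwartz, _root_.smul_apply, _root_.add_apply,
    _root_.neg_apply, map_smul, map_add, map_neg, h, TemperedDistribution.laplacianCLM_apply,
    SchwartzMap.laplacianCLM_eq, TemperedDistribution.laplacian_toTemperedDistributionCLM_eq]

/-- Schwartz functions lie in the domain of `H₀`, where `H₀` acts as a differential operator. -/
theorem schwartz_mem_graph (n : ℕ) (φ : 𝓢(Config n, ℂ)) :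
    (φ.toLp 2 volume, (oscillatorSchwartz n φ).toLp 2 volume) ∈ (harmonicOscillator n).graph := by
  rw [mem_graph_harmonicOscillator, Lp.toTemperedDistribution_toLp_eq,
    Lp.toTemperedDistribution_toLp_eq, oscillatorDistribution_coe]

/-- `U` is the one-parameter unitary group `t ↦ e^{itH}` of the (unbounded) operator `H`: it is a
strongly continuous one-parameter group of unitary operators with infinitesimal generator `iH`
(including the equality of the domains). -/
structure IsUnitaryGroupOf {n : ℕ} (H : L2 n →ₗ.[ℂ] L2 n) (U : ℝ → (L2 n ≃ₗᵢ[ℂ] L2 n)) :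
    Prop where
  map_zero : U 0 = LinearIsometryEquiv.refl ℂ (L2 n)
  map_add : ∀ s t u, U (s + t) u = U s (U t u)
  strongly_continuous : ∀ u, Continuous fun t ↦ U t u
  generator : ∀ u v, (u, v) ∈ H.graph ↔ HasDerivAt (fun t ↦ U t u) (Complex.I • v) 0

/-! ### Weyl quantization -/

section PartialFourier

variable {n : ℕ} {V : Type} [NormedAddCommGroup V] [NormedSpace ℝ V] [NormedSpace ℂ V] [IsScalarTower ℝ ℂ V]

/-- The phase `e^{i p·ξ}`. -/
def phase (p ξ : Config n) : ℂ := Complex.exp (((inner ℝ p ξ : ℝ) : ℂ) * Complex.I)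

/-- The integral `∫ e^{i p·ξ} g(q, p) dp`. -/
def partialFourierFun (g : 𝓢(Phase n, V)) (z : Phase n) : V :=
  ∫ p : Config n, phase p z.2 • g (z.1, p)

theorem norm_phase (p ξ : Config n) : ‖phase p ξ‖ = 1 := by
  simp [phase, Complex.norm_exp_ofReal_mul_I]

theorem continuous_phase (ξ : Config n) : Continuous fun p : Config n ↦ phase p ξ := by
  unfold phase; fun_prop

/-- The order of decay used for integrability on `ℝⁿ`. -/
def decayOrder (n : ℕ) : ℕ := n + 1

theorem integrable_decay (n : ℕ) :
    Integrable (fun p : Config n ↦ (1 + ‖p‖) ^ (-(decayOrder n : ℝ))) := by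
  apply integrable_one_add_norm
  simp [decayOrder]

/-- The seminorm controlling the decay of order `decayOrder n`. -/
def decaySeminorm (n : ℕ) (V : Type) [NormedAddCommGroup V] [NormedSpace ℝ V] [NormedSpace ℂ V] [IsScalarTower ℝ ℂ V] :
    Seminorm ℂ 𝓢(Phase n, V) :=
  ((2 : NNReal) ^ decayOrder n) •
    (Finset.Iic (decayOrder n, 0)).sup (schwartzSeminormFamily ℂ (Phase n) V)

theorem continuous_decaySeminorm (n : ℕ) (V : Type) [NormedAddCommGroup V] [NormedSpace ℝ V] [NormedSpace ℂ V] [IsScalarTower ℝ ℂ V] :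
    Continuous (decaySeminorm n V) := by
  have h : Continuous ((Finset.Iic (decayOrder n, 0)).sup
      (schwartzSeminormFamily ℂ (Phase n) V) : Seminorm ℂ 𝓢(Phase n, V)) := by
    exact Seminorm.continuous_finsetSup fun i _ ↦
      (schwartz_withSeminorms ℂ (Phase n) V).continuous_seminorm i
  exact h.const_smul ((2 : NNReal) ^ decayOrder n)

theorem norm_le_decay (g : 𝓢(Phase n, V)) (x p : Config n) :
    ‖g (x, p)‖ ≤ decaySeminorm n V g * (1 + ‖p‖) ^ (-(decayOrder n : ℝ)) := by
  have h := one_add_le_sup_seminorm_apply (𝕜 := ℂ) (m := (decayOrder n, 0)) (k := decayOrder n)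
    (n := 0) le_rfl le_rfl g (x, p)
  rw [norm_iteratedFDeriv_zero] at h
  have hp : (1 + ‖p‖) ^ decayOrder n ≤ (1 + ‖((x, p) : Phase n)‖) ^ decayOrder n := by
    gcongr
    exact norm_snd_le (x, p)
  rw [Real.rpow_neg (by positivity), Real.rpow_natCast, ← div_eq_mul_inv,
    le_div_iff₀ (by positivity), mul_comm]
  exact (mul_le_mul_of_nonneg_right hp (norm_nonneg _)).trans h

theorem integrable_phase_smul (g : 𝓢(Phase n, V)) (x ξ : Config n) :
    Integrable fun p : Config n ↦ phase p ξ • g (x, p) := by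
  refine ((integrable_decay n).const_mul (decaySeminorm n V g)).mono' ?_ ?_
  · have := continuous_phase ξ
    have : Continuous fun p : Config n ↦ phase p ξ • g (x, p) := by fun_prop
    exact this.aestronglyMeasurable
  · filter_upwards with p
    rw [norm_smul, norm_phase, one_mul]
    exact norm_le_decay g x p

theorem norm_partialFourierFun_le (g : 𝓢(Phase n, V)) (z : Phase n) :
    ‖partialFourierFun g z‖ ≤
      (∫ p : Config n, (1 + ‖p‖) ^ (-(decayOrder n : ℝ))) * decaySeminorm n V g := by
  rw [mul_comm, ← integral_const_mul]
  refine norm_integral_le_of_norm_le ((integrable_decay n).const_mul _) ?_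
  filter_upwards with p
  rw [norm_smul, norm_phase, one_mul]
  exact norm_le_decay g _ p

/-- Forgetting the derivative in the direction of the momentum. -/
def positionPart (n : ℕ) (V : Type) [NormedAddCommGroup V] [NormedSpace ℝ V] [NormedSpace ℂ V] [IsScalarTower ℝ ℂ V] :
    (Phase n →L[ℝ] V) →L[ℂ] (Phase n →L[ℝ] V) :=
  LinearMap.mkContinuous
    { toFun := fun A ↦ A ∘L ((ContinuousLinearMap.inl ℝ (Config n) (Config n)) ∘L
        ContinuousLinearMap.fst ℝ (Config n) (Config n))
      map_add' := fun _ _ ↦ rfl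
      map_smul' := fun _ _ ↦ rfl }
    ‖(ContinuousLinearMap.inl ℝ (Config n) (Config n)) ∘L
        ContinuousLinearMap.fst ℝ (Config n) (Config n)‖
    (fun A ↦ by rw [mul_comm]; exact A.opNorm_comp_le _)

/-- The Schwartz function `∂_x g + i p g` whose partial Fourier transform is the derivative of
that of `g`. -/
def phaseDeriv (n : ℕ) (V : Type) [NormedAddCommGroup V] [NormedSpace ℝ V] [NormedSpace ℂ V] [IsScalarTower ℝ ℂ V] :
    𝓢(Phase n, V) →L[ℂ] 𝓢(Phase n, Phase n →L[ℝ] V) :=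
  (postcompCLM (positionPart n V)) ∘L fderivCLM ℂ (Phase n) V +
    Complex.I • smulRightCLM ℂ V
      ((innerSL ℝ (E := Config n)).bilinearComp (ContinuousLinearMap.snd ℝ (Config n) (Config n))
        (ContinuousLinearMap.snd ℝ (Config n) (Config n)))

theorem phaseDeriv_apply (g : 𝓢(Phase n, V)) (x p : Config n) (w : Phase n) :
    phaseDeriv n V g (x, p) w =
      fderiv ℝ g (x, p) (w.1, 0) + Complex.I • ((inner ℝ p w.2 : ℝ) • g (x, p)) := rfl

theorem hasFDerivAt_integrand (g : 𝓢(Phase n, V)) (p : Config n) (z : Phase n) :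
    HasFDerivAt (fun z : Phase n ↦ phase p z.2 • g (z.1, p))
      (phase p z.2 • phaseDeriv n V g (z.1, p)) z := by
  have h1 : HasFDerivAt (fun z : Phase n ↦ phase p z.2)
      (phase p z.2 • (((Complex.ofRealCLM ∘L (innerSL ℝ p)) ∘L
        ContinuousLinearMap.snd ℝ (Config n) (Config n)).smulRight Complex.I)) z := by
    have : HasFDerivAt (fun z : Phase n ↦ ((inner ℝ p z.2 : ℝ) : ℂ) * Complex.I)
        (((Complex.ofRealCLM ∘L (innerSL ℝ p)) ∘L
        ContinuousLinearMap.snd ℝ (Config n) (Config n)).smulRight Complex.I) z :=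
      (((Complex.ofRealCLM ∘L (innerSL ℝ p)) ∘L
        ContinuousLinearMap.snd ℝ (Config n) (Config n)).smulRight Complex.I).hasFDerivAt
    exact this.cexp
  have h2 : HasFDerivAt (fun z : Phase n ↦ g (z.1, p))
      (fderiv ℝ g (z.1, p) ∘L ((ContinuousLinearMap.inl ℝ (Config n) (Config n)) ∘L
      ContinuousLinearMap.fst ℝ (Config n) (Config n))) z := by
    have h3 : HasFDerivAt (fun z : Phase n ↦ ((z.1, p) : Phase n))
        ((ContinuousLinearMap.inl ℝ (Config n) (Config n)) ∘L
          ContinuousLinearMap.fst ℝ (Config n) (Config n)) z := by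
      have := (ContinuousLinearMap.fst ℝ (Config n) (Config n)).hasFDerivAt (x := z)
      exact this.prodMk (hasFDerivAt_const p z)
    exact (g.hasFDerivAt (z.1, p)).comp z h3
  refine (h1.smul h2).congr_fderiv ?_
  refine ContinuousLinearMap.ext fun w ↦ ?_
  rw [_root_.smul_apply, phaseDeriv_apply, smul_add]
  change phase p z.2 • fderiv ℝ g (z.1, p) (w.1, 0) +
    (phase p z.2 * ((inner ℝ p w.2 : ℝ) * Complex.I)) • g (z.1, p) = _
  congr 1
  rw [mul_smul, mul_comm, mul_smul, ← Complex.coe_algebraMap, algebraMap_smul]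

theorem hasFDerivAt_partialFourierFun (g : 𝓢(Phase n, V)) (z : Phase n) :
    HasFDerivAt (partialFourierFun g) (partialFourierFun (phaseDeriv n V g) z) z := by
  have hint := (integrable_decay n).const_mul (decaySeminorm n _ (phaseDeriv n V g))
  have hb : ∀ᵐ p : Config n, ∀ z ∈ (Set.univ : Set (Phase n)),
      ‖phase p z.2 • phaseDeriv n V g (z.1, p)‖ ≤
        decaySeminorm n _ (phaseDeriv n V g) * (1 + ‖p‖) ^ (-(decayOrder n : ℝ)) := by
    filter_upwards with p z _
    rw [norm_smul, norm_phase, one_mul]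
    exact norm_le_decay _ _ p
  have hm : ∀ᶠ z in 𝓝 z, AEStronglyMeasurable (fun p : Config n ↦ phase p z.2 • g (z.1, p))
      volume := Eventually.of_forall fun z ↦ (integrable_phase_smul g z.1 z.2).aestronglyMeasurable
  have hm' := (integrable_phase_smul (phaseDeriv n V g) z.1 z.2).aestronglyMeasurable
  have hd : ∀ᵐ p : Config n, ∀ z ∈ (Set.univ : Set (Phase n)),
      HasFDerivAt (fun z : Phase n ↦ phase p z.2 • g (z.1, p))
        (phase p z.2 • phaseDeriv n V g (z.1, p)) z :=
    Eventually.of_forall fun p z _ ↦ hasFDerivAt_integrand g p z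
  exact hasFDerivAt_integral_of_dominated_of_fderiv_le (𝕜 := ℝ)
    (F := fun (z : Phase n) (p : Config n) ↦ phase p z.2 • g (z.1, p))
    (F' := fun (z : Phase n) (p : Config n) ↦ phase p z.2 • phaseDeriv n V g (z.1, p))
    univ_mem hm (integrable_phase_smul g z.1 z.2) hm' hb hint hd

theorem contDiff_partialFourierFun (m : ℕ) : ∀ (V : Type) [NormedAddCommGroup V]
    [NormedSpace ℝ V] [NormedSpace ℂ V] [IsScalarTower ℝ ℂ V] (g : 𝓢(Phase n, V)), ContDiff ℝ m (partialFourierFun g) := by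
  induction m with
  | zero =>
    intro V _ _ _ _ g
    exact contDiff_zero.2 (continuous_iff_continuousAt.2
      fun z ↦ (hasFDerivAt_partialFourierFun g z).continuousAt)
  | succ m ih =>
    intro V _ _ _ _ g
    have hfd : fderiv ℝ (partialFourierFun g) = partialFourierFun (phaseDeriv n V g) :=
      funext fun z ↦ (hasFDerivAt_partialFourierFun g z).fderiv
    rw [Nat.cast_add, Nat.cast_one, contDiff_succ_iff_fderiv]
    refine ⟨fun z ↦ (hasFDerivAt_partialFourierFun g z).differentiableAt, by simp, ?_⟩
    rw [hfd]
    exact ih _ _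

/-- Multiplication by a real coordinate on phase space. -/
def coordMul (n : ℕ) (V : Type) [NormedAddCommGroup V] [NormedSpace ℝ V] [NormedSpace ℂ V] [IsScalarTower ℝ ℂ V] (i : Fin n) :
    𝓢(Phase n, V) →L[ℂ] 𝓢(Phase n, V) :=
  SchwartzMap.smulLeftCLM V (fun z : Phase n ↦ ((z.1 i : ℝ) : ℂ))

theorem coordMul_apply (g : 𝓢(Phase n, V)) (i : Fin n) (z : Phase n) :
    coordMul n V i g z = ((z.1 i : ℝ) : ℂ) • g z := by
  have : (fun z : Phase n ↦ ((z.1 i : ℝ) : ℂ)).HasTemperateGrowth :=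
    (Complex.ofRealCLM ∘L (EuclideanSpace.proj (𝕜 := ℝ) i ∘L
      ContinuousLinearMap.fst ℝ (Config n) (Config n))).hasTemperateGrowth
  exact smulLeftCLM_apply_apply this g z

/-- The derivative in the direction of the `i`-th coordinate of `p`. -/
def momentumDeriv (n : ℕ) (V : Type) [NormedAddCommGroup V] [NormedSpace ℝ V] [NormedSpace ℂ V] [IsScalarTower ℝ ℂ V] (i : Fin n) :
    𝓢(Phase n, V) →L[ℂ] 𝓢(Phase n, V) :=
  SchwartzMap.evalCLM ℂ (Phase n) V ((0, EuclideanSpace.single i 1) : Phase n) ∘L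
    fderivCLM ℂ (Phase n) V

theorem partialFourierFun_coordMul (g : 𝓢(Phase n, V)) (i : Fin n) (z : Phase n) :
    partialFourierFun (coordMul n V i g) z = ((z.1 i : ℝ) : ℂ) • partialFourierFun g z := by
  simp only [partialFourierFun, coordMul_apply]
  rw [← integral_smul]
  congr 1 with p
  rw [smul_comm]

theorem partialFourierFun_momentumDeriv (g : 𝓢(Phase n, V)) (i : Fin n) (z : Phase n) :
    partialFourierFun (momentumDeriv n V i g) z =
      -(((z.2 i : ℝ) : ℂ) * Complex.I) • partialFourierFun g z := by
  have hphase (p : Config n) : HasFDerivAt (fun p : Config n ↦ phase p z.2)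
      (phase p z.2 • ((Complex.ofRealCLM ∘L (innerSL ℝ z.2)).smulRight Complex.I)) p := by
    have : HasFDerivAt (fun p : Config n ↦ ((inner ℝ p z.2 : ℝ) : ℂ) * Complex.I)
        ((Complex.ofRealCLM ∘L (innerSL ℝ z.2)).smulRight Complex.I) p := by
      have h := ((Complex.ofRealCLM ∘L (innerSL ℝ z.2)).smulRight Complex.I).hasFDerivAt (x := p)
      refine h.congr_of_eventuallyEq (Eventually.of_forall fun p ↦ ?_)
      simp only [real_inner_comm z.2 p]
      rfl
    exact this.cexp
  have hg (p : Config n) : HasFDerivAt (fun p : Config n ↦ g (z.1, p))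
      (fderiv ℝ g (z.1, p) ∘L ContinuousLinearMap.inr ℝ (Config n) (Config n)) p := by
    have h3 : HasFDerivAt (fun p : Config n ↦ ((z.1, p) : Phase n))
        (ContinuousLinearMap.inr ℝ (Config n) (Config n)) p :=
      (hasFDerivAt_const z.1 p).prodMk (hasFDerivAt_id p)
    exact (g.hasFDerivAt (z.1, p)).comp p h3
  have e1 (p : Config n) : fderiv ℝ (fun p : Config n ↦ g (z.1, p)) p (EuclideanSpace.single i 1) =
      momentumDeriv n V i g (z.1, p) := by
    rw [(hg p).fderiv]; rfl
  have e2 (p : Config n) : fderiv ℝ (fun p : Config n ↦ phase p z.2) p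
      (EuclideanSpace.single i 1) = (((z.2 i : ℝ) : ℂ) * Complex.I) * phase p z.2 := by
    have h : inner ℝ z.2 (EuclideanSpace.single i 1) = z.2 i := by
      simp [EuclideanSpace.inner_single_right]
    rw [(hphase p).fderiv, ← h, mul_comm]
    rfl
  have key := integral_smul_fderiv_eq_neg_fderiv_smul_of_integrable (μ := volume)
    (f := fun p : Config n ↦ phase p z.2) (g := fun p : Config n ↦ g (z.1, p))
    (v := EuclideanSpace.single i 1) ?_ ?_ ?_ ?_ ?_
  · simp only [e1, e2, mul_smul] at key
    rw [integral_smul, integral_smul] at key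
    simp only [partialFourierFun, key, neg_smul, mul_smul]
  · simp only [e2, mul_smul]
    exact ((integrable_phase_smul g z.1 z.2).smul Complex.I).smul ((z.2 i : ℝ) : ℂ)
  · simp only [e1]
    exact integrable_phase_smul _ z.1 z.2
  · exact integrable_phase_smul g z.1 z.2
  · exact fun p _ ↦ (hphase p).differentiableAt
  · exact fun p _ ↦ (hg p).differentiableAt

theorem norm_phase_le_sum (z : Phase n) : ‖z‖ ≤ ∑ i, (|z.1 i| + |z.2 i|) := by
  have h (x : Config n) : ‖x‖ ≤ ∑ i, |x i| := by
    calc ‖x‖ = ‖∑ i, EuclideanSpace.single i (x i)‖ := by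
          congr 1
          ext j
          simp [Finset.sum_apply]
      _ ≤ ∑ i, ‖EuclideanSpace.single i (x i)‖ := norm_sum_le _ _
      _ = ∑ i, |x i| := by simp
  rw [Finset.sum_add_distrib]
  exact (max_le_add_of_nonneg (norm_nonneg _) (norm_nonneg _)).trans (add_le_add (h _) (h _))

theorem decay_partialFourierFun (k : ℕ) : ∃ q : Seminorm ℂ 𝓢(Phase n, V), Continuous q ∧
    ∀ g z, ‖z‖ ^ k * ‖partialFourierFun g z‖ ≤ q g := by
  induction k with
  | zero =>
    have hc : 0 ≤ ∫ p : Config n, (1 + ‖p‖) ^ (-(decayOrder n : ℝ)) :=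
      integral_nonneg fun p ↦ by positivity
    let c : NNReal := ⟨_, hc⟩
    refine ⟨c • decaySeminorm n V, ?_, fun g z ↦ ?_⟩
    · exact (continuous_decaySeminorm n V).const_smul c
    · rw [pow_zero, one_mul]
      exact norm_partialFourierFun_le g z
  | succ k ih =>
    obtain ⟨q, hq, h⟩ := ih
    have hsum (g : 𝓢(Phase n, V)) : (∑ i, (q.comp (coordMul n V i).toLinearMap +
        q.comp (momentumDeriv n V i).toLinearMap)) g =
        ∑ i, (q (coordMul n V i g) + q (momentumDeriv n V i g)) := by
      rw [← FunLike.coeAddMonoidHom_apply, map_sum, Finset.sum_apply]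
      rfl
    refine ⟨∑ i, (q.comp (coordMul n V i).toLinearMap + q.comp (momentumDeriv n V i).toLinearMap),
      ?_, fun g z ↦ ?_⟩
    · rw [funext hsum]
      exact continuous_finsetSum _ fun i _ ↦ (hq.comp (coordMul n V i).continuous).add
        (hq.comp (momentumDeriv n V i).continuous)
    · have e (i : Fin n) : |z.2 i| * ‖partialFourierFun g z‖ =
          ‖partialFourierFun (momentumDeriv n V i g) z‖ := by
        rw [partialFourierFun_momentumDeriv, norm_smul]; simp
      have e' (i : Fin n) : |z.1 i| * ‖partialFourierFun g z‖ =
          ‖partialFourierFun (coordMul n V i g) z‖ := by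
        rw [partialFourierFun_coordMul, norm_smul]; simp
      calc ‖z‖ ^ (k + 1) * ‖partialFourierFun g z‖
          = ‖z‖ ^ k * (‖z‖ * ‖partialFourierFun g z‖) := by ring
        _ ≤ ‖z‖ ^ k * ((∑ i, (|z.1 i| + |z.2 i|)) * ‖partialFourierFun g z‖) := by
          gcongr; exact norm_phase_le_sum z
        _ = ∑ i, (‖z‖ ^ k * ‖partialFourierFun (coordMul n V i g) z‖ +
              ‖z‖ ^ k * ‖partialFourierFun (momentumDeriv n V i g) z‖) := by
          rw [Finset.sum_mul, Finset.mul_sum]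
          refine Finset.sum_congr rfl fun i _ ↦ ?_
          rw [← e, ← e']; ring
        _ ≤ ∑ i, (q (coordMul n V i g) + q (momentumDeriv n V i g)) := by
          gcongr <;> exact h _ _
        _ = _ := (hsum g).symm

theorem decay_iteratedFDeriv_partialFourierFun (k m : ℕ) : ∀ (V : Type) [NormedAddCommGroup V]
    [NormedSpace ℝ V] [NormedSpace ℂ V] [IsScalarTower ℝ ℂ V], ∃ q : Seminorm ℂ 𝓢(Phase n, V), Continuous q ∧
    ∀ g z, ‖z‖ ^ k * ‖iteratedFDeriv ℝ m (partialFourierFun g) z‖ ≤ q g := by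
  induction m with
  | zero =>
    intro V _ _ _ _
    simpa only [norm_iteratedFDeriv_zero] using decay_partialFourierFun (n := n) (V := V) k
  | succ m ih =>
    intro V _ _ _ _
    obtain ⟨q, hq, h⟩ := ih (Phase n →L[ℝ] V)
    refine ⟨q.comp (phaseDeriv n V).toLinearMap, hq.comp (phaseDeriv n V).continuous,
      fun g z ↦ ?_⟩
    have hfd : fderiv ℝ (partialFourierFun g) = partialFourierFun (phaseDeriv n V g) :=
      funext fun z ↦ (hasFDerivAt_partialFourierFun g z).fderiv
    rw [← norm_iteratedFDeriv_fderiv, hfd]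
    exact h _ z

end PartialFourier

/-- The partial Fourier transform `g ↦ ((q, ξ) ↦ ∫ e^{i p·ξ} g(q, p) dp)` on Schwartz functions. -/
def partialFourier (n : ℕ) : 𝓢(Phase n, ℂ) →L[ℂ] 𝓢(Phase n, ℂ) :=
  SchwartzMap.mkCLM partialFourierFun
    (fun f g z ↦ by
      simp only [partialFourierFun, _root_.add_apply, smul_add]
      exact integral_add (integrable_phase_smul f z.1 z.2) (integrable_phase_smul g z.1 z.2))
    (fun a f z ↦ by
      simp only [partialFourierFun, _root_.smul_apply, RingHom.id_apply]
      rw [← integral_smul]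
      congr 1 with p
      rw [smul_comm])
    (fun g ↦ contDiff_infty.2 fun m ↦ contDiff_partialFourierFun m ℂ g)
    (fun m ↦ by
      obtain ⟨q, hq, h⟩ := decay_iteratedFDeriv_partialFourierFun (n := n) m.1 m.2 ℂ
      obtain ⟨s, C, -, hC⟩ := Seminorm.bound_of_continuous
        (schwartz_withSeminorms ℂ (Phase n) ℂ) q hq
      exact ⟨s, C, C.2, fun g z ↦ (h g z).trans (hC g)⟩)

theorem partialFourier_apply (n : ℕ) (g : 𝓢(Phase n, ℂ)) (q ξ : Config n) :
    partialFourier n g (q, ξ) =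
      ∫ p : Config n, Complex.exp (((inner ℝ p ξ : ℝ) : ℂ) * Complex.I) * g (q, p) := rfl

/-- The linear change of variables `(q, p) ↦ (q + p / 2, q - p / 2)`. -/
def midpointChange (n : ℕ) : Phase n ≃L[ℝ] Phase n :=
  ContinuousLinearEquiv.equivOfInverse
    ((ContinuousLinearMap.fst ℝ (Config n) (Config n)
        + (1 / 2 : ℝ) • ContinuousLinearMap.snd ℝ (Config n) (Config n)).prod
      (ContinuousLinearMap.fst ℝ (Config n) (Config n)
        - (1 / 2 : ℝ) • ContinuousLinearMap.snd ℝ (Config n) (Config n)))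
    (((1 / 2 : ℝ) • (ContinuousLinearMap.fst ℝ (Config n) (Config n)
        + ContinuousLinearMap.snd ℝ (Config n) (Config n))).prod
      (ContinuousLinearMap.fst ℝ (Config n) (Config n)
        - ContinuousLinearMap.snd ℝ (Config n) (Config n)))
    (by
      rintro ⟨x, ξ⟩
      ext i
      · simp; ring
      · simp; ring)
    (by
      rintro ⟨x, ξ⟩
      ext i
      · simp; ring
      · simp; ring)

theorem midpointChange_apply (n : ℕ) (q p : Config n) :
    midpointChange n (q, p) = (q + (1 / 2 : ℝ) • p, q - (1 / 2 : ℝ) • p) := rfl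

/-- The transpose of the map `f ↦ K_f`:
`g ↦ ((q, ξ) ↦ ∫ e^{i p·ξ} g(q + p / 2, q - p / 2) dp)`. -/
def kernelTranspose (n : ℕ) : 𝓢(Phase n, ℂ) →L[ℂ] 𝓢(Phase n, ℂ) :=
  partialFourier n ∘L compCLMOfContinuousLinearEquiv ℂ (midpointChange n)

theorem kernelTranspose_apply (n : ℕ) (g : 𝓢(Phase n, ℂ)) (q ξ : Config n) :
    kernelTranspose n g (q, ξ) =
      ∫ p : Config n, Complex.exp (((inner ℝ p ξ : ℝ) : ℂ) * Complex.I) *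
        g (q + (1 / 2 : ℝ) • p, q - (1 / 2 : ℝ) • p) := rfl

/-- The Schwartz kernel `K_f(x, y) = ∫ f((x + y) / 2, ξ) e^{i (x - y)·ξ} dξ` of the Weyl
quantization, extended to tempered distributions `f` by duality: after the substitution
`x = q + p / 2`, `y = q - p / 2`, which preserves Lebesgue measure,
`K_f(g) = ∫∫ f(q, ξ) (∫ e^{i p·ξ} g(q + p / 2, q - p / 2) dp) dq dξ`. -/
def weylKernel (n : ℕ) (f : 𝓢'(Phase n, ℂ)) : 𝓢'(Phase n, ℂ) :=
  PointwiseConvergenceCLM.precomp ℂ (kernelTranspose n) f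

section Tensor

variable {n : ℕ}

/-- The function `(v ⊗ u)(x, y) = v(x) u(y)`. -/
def tensorFun (v u : 𝓢(Config n, ℂ)) (z : Phase n) : ℂ := v z.1 * u z.2

theorem contDiff_tensorFun (v u : 𝓢(Config n, ℂ)) : ContDiff ℝ ∞ (tensorFun v u) :=
  ((v.smooth ⊤).comp contDiff_fst).mul ((u.smooth ⊤).comp contDiff_snd)

theorem norm_iteratedFDeriv_comp_le {A : Phase n →L[ℝ] Config n} (hA : ‖A‖ ≤ 1)
    (v : 𝓢(Config n, ℂ)) (i : ℕ) (z : Phase n) :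
    ‖iteratedFDeriv ℝ i (v ∘ A) z‖ ≤ ‖iteratedFDeriv ℝ i v (A z)‖ := by
  rw [A.iteratedFDeriv_comp_right (v.smooth ⊤) z (mod_cast le_top)]
  refine (ContinuousMultilinearMap.norm_compContinuousLinearMap_le _ _).trans ?_
  refine mul_le_of_le_one_right (norm_nonneg _) ?_
  exact Finset.prod_le_one (fun _ _ ↦ norm_nonneg _) fun _ _ ↦ hA

/-- The bound on the seminorms of `v ⊗ u`. -/
theorem tensorFun_bound (v u : 𝓢(Config n, ℂ)) (k m : ℕ) (z : Phase n) :
    ‖z‖ ^ k * ‖iteratedFDeriv ℝ m (tensorFun v u) z‖ ≤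
      ∑ i ∈ Finset.range (m + 1), (m.choose i : ℝ) *
        (SchwartzMap.seminorm ℂ k i v * SchwartzMap.seminorm ℂ 0 (m - i) u +
          SchwartzMap.seminorm ℂ 0 i v * SchwartzMap.seminorm ℂ k (m - i) u) := by
  have hm := norm_iteratedFDeriv_mul_le (n := m) ((v.smooth ⊤).comp contDiff_fst)
    ((u.smooth ⊤).comp contDiff_snd) z (mod_cast le_top)
  have hz : ‖z‖ ^ k ≤ ‖z.1‖ ^ k + ‖z.2‖ ^ k := by
    rcases max_choice ‖z.1‖ ‖z.2‖ with h | h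
    · rw [Prod.norm_def, h]; exact le_add_of_nonneg_right (by positivity)
    · rw [Prod.norm_def, h]; exact le_add_of_nonneg_left (by positivity)
  refine (mul_le_mul_of_nonneg_left hm (by positivity)).trans ?_
  rw [Finset.mul_sum]
  refine Finset.sum_le_sum fun i _ ↦ ?_
  have h1 : ‖iteratedFDeriv ℝ i (v ∘ Prod.fst) z‖ ≤ ‖iteratedFDeriv ℝ i v z.1‖ :=
    norm_iteratedFDeriv_comp_le (ContinuousLinearMap.norm_fst_le ℝ (Config n) (Config n)) v i z
  have h2 : ‖iteratedFDeriv ℝ (m - i) (u ∘ Prod.snd) z‖ ≤ ‖iteratedFDeriv ℝ (m - i) u z.2‖ :=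
    norm_iteratedFDeriv_comp_le (ContinuousLinearMap.norm_snd_le ℝ (Config n) (Config n)) u _ z
  have a1 := SchwartzMap.le_seminorm ℂ k i v z.1
  have a2 := SchwartzMap.norm_iteratedFDeriv_le_seminorm ℂ v i z.1
  have b1 := SchwartzMap.le_seminorm ℂ k (m - i) u z.2
  have b2 := SchwartzMap.norm_iteratedFDeriv_le_seminorm ℂ u (m - i) z.2
  calc ‖z‖ ^ k * ((m.choose i : ℝ) * ‖iteratedFDeriv ℝ i (v ∘ Prod.fst) z‖ *
        ‖iteratedFDeriv ℝ (m - i) (u ∘ Prod.snd) z‖)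
      ≤ (‖z.1‖ ^ k + ‖z.2‖ ^ k) * ((m.choose i : ℝ) * ‖iteratedFDeriv ℝ i v z.1‖ *
        ‖iteratedFDeriv ℝ (m - i) u z.2‖) := by gcongr
    _ = (m.choose i : ℝ) * ((‖z.1‖ ^ k * ‖iteratedFDeriv ℝ i v z.1‖) *
          ‖iteratedFDeriv ℝ (m - i) u z.2‖ + ‖iteratedFDeriv ℝ i v z.1‖ *
          (‖z.2‖ ^ k * ‖iteratedFDeriv ℝ (m - i) u z.2‖)) := by ring
    _ ≤ _ := by gcongr

/-- The continuous linear map `v ↦ v ⊗ u` for fixed `u`. -/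
def tensorLeft (u : 𝓢(Config n, ℂ)) : 𝓢(Config n, ℂ) →L[ℂ] 𝓢(Phase n, ℂ) :=
  SchwartzMap.mkCLM (fun v ↦ tensorFun v u)
    (fun v w z ↦ by simp [tensorFun, add_mul])
    (fun a v z ↦ by simp [tensorFun, mul_assoc])
    (fun v ↦ contDiff_tensorFun v u)
    (fun ⟨k, m⟩ ↦ by
      refine ⟨Finset.Iic (k, m), ∑ i ∈ Finset.range (m + 1), (m.choose i : ℝ) *
        (SchwartzMap.seminorm ℂ 0 (m - i) u + SchwartzMap.seminorm ℂ k (m - i) u),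
        by positivity, fun v z ↦ (tensorFun_bound v u k m z).trans ?_⟩
      rw [Finset.sum_mul]
      refine Finset.sum_le_sum fun i hi ↦ ?_
      have hle (j : ℕ) (hj : j ≤ k) : SchwartzMap.seminorm ℂ j i v ≤
          (Finset.Iic (k, m)).sup (schwartzSeminormFamily ℂ (Config n) ℂ) v :=
        Seminorm.le_def.1 (Finset.le_sup (f := schwartzSeminormFamily ℂ (Config n) ℂ)
          (Finset.mem_Iic.2 (Prod.mk_le_mk.2 ⟨hj, by simpa [Nat.lt_succ_iff] using hi⟩))) v
      have h1 := hle k le_rfl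
      have h2 := hle 0 (Nat.zero_le _)
      rw [mul_assoc, add_mul, mul_comm (SchwartzMap.seminorm ℂ 0 (m - i) u),
        mul_comm (SchwartzMap.seminorm ℂ k (m - i) u)]
      gcongr)

theorem tensorLeft_apply (v u : 𝓢(Config n, ℂ)) (x y : Config n) :
    tensorLeft u v (x, y) = v x * u y := rfl

/-- Exchanging the two variables. -/
def swapVariables (n : ℕ) : 𝓢(Phase n, ℂ) →L[ℂ] 𝓢(Phase n, ℂ) :=
  compCLMOfContinuousLinearEquiv ℂ (ContinuousLinearEquiv.prodComm ℝ (Config n) (Config n))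

theorem tensorLeft_eq_swap (v u : 𝓢(Config n, ℂ)) :
    tensorLeft u v = swapVariables n (tensorLeft v u) := by
  ext ⟨x, y⟩
  exact mul_comm (v x) (u y)

end Tensor

/-- The Weyl quantization `Op(f) : 𝓢(ℝⁿ) → 𝓢'(ℝⁿ)` of a tempered distribution `f` on phase
space, `(Op(f) u)(v) = K_f(v ⊗ u)`. -/
def weylOp (n : ℕ) (f : 𝓢'(Phase n, ℂ)) : 𝓢(Config n, ℂ) →L[ℂ] 𝓢'(Config n, ℂ) where
  toFun u := PointwiseConvergenceCLM.precomp ℂ (tensorLeft u) (weylKernel n f)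
  map_add' u w := by
    ext v
    change weylKernel n f (tensorLeft (u + w) v) =
      weylKernel n f (tensorLeft u v) + weylKernel n f (tensorLeft w v)
    rw [tensorLeft_eq_swap, map_add, map_add, ← tensorLeft_eq_swap, ← tensorLeft_eq_swap, map_add]
  map_smul' a u := by
    ext v
    change weylKernel n f (tensorLeft (a • u) v) = a • weylKernel n f (tensorLeft u v)
    rw [tensorLeft_eq_swap, map_smul, map_smul, ← tensorLeft_eq_swap, map_smul]
  cont := by
    refine PointwiseConvergenceCLM.continuous_of_continuous_eval fun v ↦ ?_
    change Continuous fun u ↦ weylKernel n f (tensorLeft u v)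
    simp only [tensorLeft_eq_swap v]
    exact (weylKernel n f).continuous.comp
      ((swapVariables n).continuous.comp (tensorLeft v).continuous)

theorem weylOp_apply (n : ℕ) (f : 𝓢'(Phase n, ℂ)) (u v : 𝓢(Config n, ℂ)) :
    weylOp n f u v = weylKernel n f (tensorLeft u v) := rfl

end HarmonicWeyl

/-!
The propagator `e^{itH₀}` is a metaplectic representative of a rotation of phase space by the angle
`t`, and for `|t| < π` that rotation is a product of three shears with the parameters `tan (t / 2)`,
`sin t` and `tan (t / 2)`. Accordingly `shortProp` is the product of a multiplication by the chirp
`e^{i tan (t / 2) ‖x‖² / 2}`, the free propagator `e^{i sin t |D|² / 2}`, and the same chirp.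
Each factor is a continuous automorphism of Schwartz
space that preserves the `L²` norm and intertwines position and momentum by a shear. Comparing the
coefficients of `D²`, `xD + Dx` and `x²` in the product rule shows, with no phase correction, that
`shortProp` solves the Schrödinger equation (`hasDerivAt_toL2_shortProp`). Uniqueness of solutions
gives the local group law `shortProp_add`, and a local one-parameter group extends to `ℝ`
(`extendGroupHom`). This is `schwartzGroup`, and `unitaryGroup` is its closure on `L²`.

The generator of `unitaryGroup` is `i H₀` with its maximal domain: the propagator is symmetric for
the bilinear pairing `∫ u v`, so that pairing with Schwartz functions turns the differential
equation in `L²` into the distributional identity `H₀ u = v` and back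
(`isUnitaryGroupOf_unitaryGroup`). A unitary group is determined by its densely defined generator
(`IsUnitaryGroupOf.unique`).

The quantization satisfies `(Op(f) u)(v) = f(W(v, u))` with the Wigner transform `W`. A chirp shears
`W` in the momentum variable by a direct computation; the free propagator shears it in the position
variable, as one sees after a Fourier transform in that variable. Hence
`W(e^{itH₀} v, e^{-itH₀} u) = W(v, u) ∘ φ_{-t}` (`wigner_schwartzGroup`), which is the invariance of
`Op(f)` for a constant of motion `f`. For the commutator, the Moyal bracket with a quadratic
Hamiltonian is the Poisson bracket, `W(H₀ v, u) - W(v, H₀ u) = i X W(v, u)` with `X` the derivative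
along the flow (`wigner_oscillatorSchwartz_sub`), and `f (X g) = 0` because
`(g ∘ φ_t - g) / t` converges to `X g` in the Schwartz topology (`seminorm_flowRemainder_le`).
-/

namespace HarmonicWeyl

open LineDeriv FourierTransform

variable {n : ℕ}

/-! ### Chirps and the free propagator -/

theorem hasDerivAt_cexp_ofReal_mul_I (x : ℝ) :
    HasDerivAt (fun r : ℝ ↦ Complex.exp (r * Complex.I))
      (Complex.exp (x * Complex.I) * Complex.I) x := by
  have h : HasDerivAt (fun r : ℝ ↦ (r : ℂ) * Complex.I) Complex.I x := by
    simpa using (Complex.ofRealCLM.hasDerivAt (x := x)).mul_const Complex.I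
  exact h.cexp

theorem iteratedDeriv_cexp_ofReal_mul_I (m : ℕ) :
    iteratedDeriv m (fun r : ℝ ↦ Complex.exp (r * Complex.I)) =
      fun r : ℝ ↦ Complex.I ^ m * Complex.exp (r * Complex.I) := by
  induction m with
  | zero => simp
  | succ m ih =>
    rw [iteratedDeriv_succ, ih]
    funext r
    rw [((hasDerivAt_cexp_ofReal_mul_I r).const_mul (Complex.I ^ m)).deriv]
    ring

theorem hasTemperateGrowth_cexp_ofReal_mul_I :
    (fun r : ℝ ↦ Complex.exp (r * Complex.I)).HasTemperateGrowth := by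
  refine ⟨(Complex.ofRealCLM.contDiff.mul contDiff_const).cexp, fun m ↦ ⟨0, 1, fun x ↦ ?_⟩⟩
  rw [norm_iteratedFDeriv_eq_norm_iteratedDeriv, iteratedDeriv_cexp_ofReal_mul_I]
  simp [Complex.norm_exp_ofReal_mul_I]

/-- The chirp `x ↦ e^{i a ‖x‖² / 2}`. -/
def chirp (n : ℕ) (a : ℝ) (x : Config n) : ℂ :=
  Complex.exp (((a / 2 * ‖x‖ ^ 2 : ℝ) : ℂ) * Complex.I)

theorem hasTemperateGrowth_chirp (a : ℝ) : (chirp n a).HasTemperateGrowth := by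
  have h : (fun x : Config n ↦ a / 2 * ‖x‖ ^ 2).HasTemperateGrowth :=
    (Function.HasTemperateGrowth.const (a / 2)).mul (Function.hasTemperateGrowth_norm_sq _)
  exact hasTemperateGrowth_cexp_ofReal_mul_I.comp h

theorem norm_chirp (a : ℝ) (x : Config n) : ‖chirp n a x‖ = 1 :=
  Complex.norm_exp_ofReal_mul_I _

theorem chirp_add (a b : ℝ) : chirp n (a + b) = chirp n a * chirp n b := by
  funext x
  simp only [chirp, Pi.mul_apply, ← Complex.exp_add]
  congr 1
  push_cast
  ring

theorem chirp_zero : chirp n 0 = fun _ ↦ 1 := by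
  funext x
  simp [chirp]

/-- Multiplication by the chirp `e^{i a ‖x‖² / 2}`. -/
def chirpMul (n : ℕ) (a : ℝ) : 𝓢(Config n, ℂ) →L[ℂ] 𝓢(Config n, ℂ) :=
  smulLeftCLM ℂ (chirp n a)

theorem chirpMul_apply (a : ℝ) (φ : 𝓢(Config n, ℂ)) (x : Config n) :
    chirpMul n a φ x = chirp n a x * φ x :=
  smulLeftCLM_apply_apply (hasTemperateGrowth_chirp a) φ x

theorem chirpMul_chirpMul (a b : ℝ) (φ : 𝓢(Config n, ℂ)) :
    chirpMul n a (chirpMul n b φ) = chirpMul n (a + b) φ := by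
  ext x
  simp only [chirpMul_apply, chirp_add, Pi.mul_apply, mul_assoc]

theorem chirpMul_zero (φ : 𝓢(Config n, ℂ)) : chirpMul n 0 φ = φ := by
  ext x
  simp [chirpMul_apply, chirp_zero]

/-- The free propagator `e^{i b |D|² / 2}` with `D = -i ∇`. Mathlib's Fourier transform
has the phase `e^{-2π i x·ξ}`, so that `|D|²` is multiplication by `(2π)² ‖ξ‖²`. -/
def freeProp (n : ℕ) (b : ℝ) : 𝓢(Config n, ℂ) →L[ℂ] 𝓢(Config n, ℂ) :=
  fourierMultiplierCLM ℂ (chirp n ((2 * Real.pi) ^ 2 * b))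

theorem freeProp_apply (b : ℝ) (φ : 𝓢(Config n, ℂ)) :
    freeProp n b φ = 𝓕⁻ (chirpMul n ((2 * Real.pi) ^ 2 * b) (𝓕 φ)) := rfl

theorem freeProp_freeProp (a b : ℝ) (φ : 𝓢(Config n, ℂ)) :
    freeProp n a (freeProp n b φ) = freeProp n (a + b) φ := by
  simp only [freeProp_apply, fourier_fourierInv_eq, chirpMul_chirpMul, mul_add]

theorem freeProp_zero (φ : 𝓢(Config n, ℂ)) : freeProp n 0 φ = φ := by
  simp only [freeProp_apply, mul_zero, chirpMul_zero, fourierInv_fourier_eq]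

/-! ### Position and momentum operators -/

/-- The position operator in the direction `m`: multiplication by `⟪x, m⟫`. -/
def position (m : Config n) : 𝓢(Config n, ℂ) →L[ℂ] 𝓢(Config n, ℂ) :=
  smulLeftCLM ℂ (fun x : Config n ↦ ((inner ℝ x m : ℝ) : ℂ))

theorem position_apply (m : Config n) (φ : 𝓢(Config n, ℂ)) (x : Config n) :
    position m φ x = ((inner ℝ x m : ℝ) : ℂ) * φ x :=
  smulLeftCLM_apply_apply (Function.Complex.hasTemperateGrowth_ofReal.comp
    (Function.hasTemperateGrowth_inner_left m)) φ x

theorem position_eq_real (m : Config n) (φ : 𝓢(Config n, ℂ)) :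
    position m φ = smulLeftCLM ℂ (inner ℝ · m) φ := by
  ext x
  have : (inner ℝ · m : Config n → ℝ).HasTemperateGrowth :=
    Function.hasTemperateGrowth_inner_left m
  rw [position_apply, smulLeftCLM_apply_apply this, Complex.real_smul]

/-- The momentum operator `-i ∂_m` in the direction `m`. -/
def momentum (m : Config n) : 𝓢(Config n, ℂ) →L[ℂ] 𝓢(Config n, ℂ) :=
  (-Complex.I) • lineDerivOpCLM ℂ 𝓢(Config n, ℂ) m

theorem momentum_apply (m : Config n) (φ : 𝓢(Config n, ℂ)) :
    momentum m φ = (-Complex.I) • ∂_{m} φ := rfl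

theorem lineDeriv_eq_momentum (m : Config n) (φ : 𝓢(Config n, ℂ)) :
    ∂_{m} φ = Complex.I • momentum m φ := by
  rw [momentum_apply, smul_smul]; simp

theorem position_chirpMul (m : Config n) (a : ℝ) (φ : 𝓢(Config n, ℂ)) :
    position m (chirpMul n a φ) = chirpMul n a (position m φ) := by
  ext x
  simp only [position_apply, chirpMul_apply]
  ring

theorem hasFDerivAt_chirp (a : ℝ) (x : Config n) :
    HasFDerivAt (chirp n a)
      (chirp n a x • ((a • (Complex.ofRealCLM ∘L innerSL ℝ x)).smulRight Complex.I)) x := by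
  have h1 : HasFDerivAt (fun x : Config n ↦ (((a / 2 * ‖x‖ ^ 2 : ℝ) : ℂ)) * Complex.I)
      ((a • (Complex.ofRealCLM ∘L innerSL ℝ x)).smulRight Complex.I) x := by
    have h0 := ((hasStrictFDerivAt_norm_sq x).hasFDerivAt.const_mul (a / 2))
    have h2 := (Complex.ofRealCLM.hasFDerivAt.comp x h0).mul_const Complex.I
    refine h2.congr_fderiv ?_
    ext v
    simp
    ring
  exact h1.cexp

theorem momentum_chirpMul (m : Config n) (a : ℝ) (φ : 𝓢(Config n, ℂ)) :
    momentum m (chirpMul n a φ) = chirpMul n a (momentum m φ + (a : ℂ) • position m φ) := by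
  ext x
  have h : HasFDerivAt (chirpMul n a φ) _ x :=
    ((hasFDerivAt_chirp a x).mul (φ.hasFDerivAt x)).congr_of_eventuallyEq
      (Eventually.of_forall fun y ↦ chirpMul_apply a φ y)
  rw [momentum_apply, _root_.smul_apply, lineDerivOp_apply_eq_fderiv, h.fderiv, chirpMul_apply,
    _root_.add_apply, _root_.smul_apply, momentum_apply]
  simp only [position_apply, lineDerivOp_apply_eq_fderiv, _root_.add_apply,
    _root_.smul_apply, ContinuousLinearMap.smulRight_apply,
    ContinuousLinearMap.comp_apply, innerSL_apply_apply, Complex.ofRealCLM_apply, smul_eq_mul,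
    Complex.real_smul]
  linear_combination (-(φ x * chirp n a x * a * (inner ℝ x m : ℝ)) : ℂ) * Complex.I_sq

theorem position_fourierInv (m : Config n) (φ : 𝓢(Config n, ℂ)) :
    position m (𝓕⁻ φ) = 𝓕⁻ ((-(2 * Real.pi : ℂ)⁻¹) • momentum m φ) := by
  have h := fourierInv_lineDerivOp_eq φ m
  rw [← position_eq_real, lineDeriv_eq_momentum, FourierTransform.fourierInv_smul] at h
  have hpi : (2 * Real.pi : ℂ) ≠ 0 := by simp [Real.pi_ne_zero]
  rw [FourierTransform.fourierInv_smul]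
  have h2 := congrArg (fun ψ ↦ ((2 * Real.pi : ℂ)⁻¹ * Complex.I) • ψ) h
  simp only [smul_smul] at h2
  have e1 : (2 * Real.pi : ℂ)⁻¹ * Complex.I * Complex.I = -(2 * Real.pi : ℂ)⁻¹ := by
    rw [mul_assoc, Complex.I_mul_I]; ring
  have e2 : (2 * Real.pi : ℂ)⁻¹ * Complex.I * -(2 * Real.pi * Complex.I) = 1 := by
    field_simp
    simp
  rw [e1, e2, one_smul] at h2
  exact h2.symm

theorem momentum_fourierInv (m : Config n) (φ : 𝓢(Config n, ℂ)) :
    momentum m (𝓕⁻ φ) = 𝓕⁻ ((2 * Real.pi : ℂ) • position m φ) := by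
  rw [momentum_apply, lineDerivOp_fourierInv_eq, ← position_eq_real,
    ← FourierTransform.fourierInv_smul, smul_smul]
  congr 2
  linear_combination (-(2 * Real.pi) : ℂ) * Complex.I_sq

theorem fourier_position (m : Config n) (φ : 𝓢(Config n, ℂ)) :
    𝓕 (position m φ) = (-(2 * Real.pi : ℂ)⁻¹) • momentum m (𝓕 φ) := by
  have h := position_fourierInv m (𝓕 φ)
  rw [fourierInv_fourier_eq] at h
  rw [h, fourier_fourierInv_eq]

theorem fourier_momentum (m : Config n) (φ : 𝓢(Config n, ℂ)) :
    𝓕 (momentum m φ) = (2 * Real.pi : ℂ) • position m (𝓕 φ) := by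
  have h := momentum_fourierInv m (𝓕 φ)
  rw [fourierInv_fourier_eq] at h
  rw [h, fourier_fourierInv_eq]

theorem momentum_freeProp (m : Config n) (b : ℝ) (φ : 𝓢(Config n, ℂ)) :
    momentum m (freeProp n b φ) = freeProp n b (momentum m φ) := by
  rw [freeProp_apply, momentum_fourierInv, position_chirpMul, freeProp_apply, fourier_momentum,
    map_smul]

theorem position_freeProp (m : Config n) (b : ℝ) (φ : 𝓢(Config n, ℂ)) :
    position m (freeProp n b φ) = freeProp n b (position m φ - (b : ℂ) • momentum m φ) := by
  have hpi : (2 * Real.pi : ℂ) ≠ 0 := by simp [Real.pi_ne_zero]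
  rw [freeProp_apply, position_fourierInv, momentum_chirpMul, freeProp_apply,
    sub_eq_add_neg, FourierTransform.fourier_add, ← neg_smul, FourierTransform.fourier_smul,
    fourier_position, fourier_momentum, ← map_smul, smul_add, smul_smul, smul_smul]
  congr 4
  push_cast
  field_simp

/-- The coordinate directions of `ℝⁿ`. -/
abbrev coordDir (j : Fin n) : Config n := EuclideanSpace.basisFun (Fin n) ℝ j

/-- The potential energy `‖x‖² / 2` on Schwartz functions. -/
def potential (n : ℕ) : 𝓢(Config n, ℂ) →L[ℂ] 𝓢(Config n, ℂ) :=
  (1 / 2 : ℂ) • ∑ j, position (coordDir j) ∘L position (coordDir j)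

/-- The kinetic energy `|D|² / 2` on Schwartz functions. -/
def kinetic (n : ℕ) : 𝓢(Config n, ℂ) →L[ℂ] 𝓢(Config n, ℂ) :=
  (1 / 2 : ℂ) • ∑ j, momentum (coordDir j) ∘L momentum (coordDir j)

theorem potential_eq_sum (φ : 𝓢(Config n, ℂ)) :
    potential n φ = (1 / 2 : ℂ) • ∑ j, position (coordDir j) (position (coordDir j) φ) := by
  simp only [potential, _root_.smul_apply, _root_.sum_apply, ContinuousLinearMap.comp_apply]

theorem kinetic_eq_sum (φ : 𝓢(Config n, ℂ)) :
    kinetic n φ = (1 / 2 : ℂ) • ∑ j, momentum (coordDir j) (momentum (coordDir j) φ) := by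
  simp only [kinetic, _root_.smul_apply, _root_.sum_apply, ContinuousLinearMap.comp_apply]

theorem potential_apply (φ : 𝓢(Config n, ℂ)) (x : Config n) :
    potential n φ x = ((1 / 2 * ‖x‖ ^ 2 : ℝ) : ℂ) * φ x := by
  rw [potential_eq_sum, ← (EuclideanSpace.basisFun (Fin n) ℝ).sum_sq_inner_left x]
  simp only [_root_.smul_apply, _root_.sum_apply, position_apply, smul_eq_mul]
  push_cast
  rw [mul_assoc, Finset.sum_mul]
  congr 1
  refine Finset.sum_congr rfl fun j _ ↦ ?_
  ring

theorem oscillatorSchwartz_eq (φ : 𝓢(Config n, ℂ)) :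
    oscillatorSchwartz n φ = potential n φ + kinetic n φ := by
  have hΔ : LineDeriv.laplacianCLM ℂ (Config n) 𝓢(Config n, ℂ) φ =
      -∑ j, momentum (coordDir j) (momentum (coordDir j) φ) := by
    rw [SchwartzMap.laplacianCLM_eq, laplacian_eq_sum (EuclideanSpace.basisFun (Fin n) ℝ),
      ← Finset.sum_neg_distrib]
    refine Finset.sum_congr rfl fun j _ ↦ ?_
    rw [lineDeriv_eq_momentum, lineDeriv_eq_momentum, map_smul, smul_smul, Complex.I_mul_I,
      neg_one_smul]
  have hx : SchwartzMap.smulLeftCLM ℂ (fun x : Config n ↦ ((‖x‖ ^ 2 : ℝ) : ℂ)) φ =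
      (2 : ℂ) • potential n φ := by
    ext x
    rw [smulLeftCLM_apply_apply (hasTemperateGrowth_normSq n), _root_.smul_apply, potential_apply,
      smul_eq_mul, smul_eq_mul]
    push_cast
    ring
  rw [kinetic_eq_sum]
  simp only [oscillatorSchwartz, _root_.smul_apply, _root_.add_apply, _root_.neg_apply, hΔ, hx]
  module

/-! ### The propagator for short times -/

/-- The propagator `e^{i t H₀}` for `|t| < π`, factored like the rotation by the angle `t` into three
shears with the parameters `tan (t / 2)`, `sin t` and `tan (t / 2)`. -/
def shortProp (n : ℕ) (t : ℝ) : 𝓢(Config n, ℂ) →L[ℂ] 𝓢(Config n, ℂ) :=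
  chirpMul n (Real.tan (t / 2)) ∘L freeProp n (Real.sin t) ∘L chirpMul n (Real.tan (t / 2))

theorem shortProp_apply (t : ℝ) (φ : 𝓢(Config n, ℂ)) :
    shortProp n t φ =
      chirpMul n (Real.tan (t / 2)) (freeProp n (Real.sin t) (chirpMul n (Real.tan (t / 2)) φ)) :=
  rfl

theorem shortProp_zero (φ : 𝓢(Config n, ℂ)) : shortProp n 0 φ = φ := by
  simp [shortProp_apply, chirpMul_zero, freeProp_zero]

theorem shortProp_neg_apply (t : ℝ) (φ : 𝓢(Config n, ℂ)) :
    shortProp n (-t) (shortProp n t φ) = φ := by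
  simp only [shortProp_apply, neg_div, Real.tan_neg, Real.sin_neg, chirpMul_chirpMul,
    freeProp_freeProp, neg_add_cancel, chirpMul_zero, freeProp_zero]

theorem cos_half_ne_zero {t : ℝ} (ht : |t| < Real.pi) : Real.cos (t / 2) ≠ 0 := by
  obtain ⟨h1, h2⟩ := abs_lt.1 ht
  exact (Real.cos_pos_of_mem_Ioo ⟨by linarith, by linarith⟩).ne'

/-- The half-angle formula `1 - tan (t / 2) sin t = cos t`. -/
theorem tan_half_mul_sin {t : ℝ} (ht : |t| < Real.pi) :
    Real.tan (t / 2) * Real.sin t = 1 - Real.cos t := by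
  have hc := cos_half_ne_zero ht
  have h1 : Real.sin t = 2 * Real.sin (t / 2) * Real.cos (t / 2) := by
    rw [← Real.sin_two_mul]; ring_nf
  have h2 : Real.cos t = 1 - 2 * Real.sin (t / 2) ^ 2 := by
    rw [← Real.cos_two_mul_eq_one_sub]; ring_nf
  rw [Real.tan_eq_sin_div_cos, h1, h2]
  field_simp
  ring

/-- The half-angle formula `tan (t / 2) (1 + cos t) = sin t`. -/
theorem tan_half_mul_one_add_cos {t : ℝ} (ht : |t| < Real.pi) :
    Real.tan (t / 2) * (1 + Real.cos t) = Real.sin t := by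
  have hc := cos_half_ne_zero ht
  have h1 : Real.sin t = 2 * Real.sin (t / 2) * Real.cos (t / 2) := by
    rw [← Real.sin_two_mul]; ring_nf
  have h2 : Real.cos t = 2 * Real.cos (t / 2) ^ 2 - 1 := by
    rw [← Real.cos_two_mul]; ring_nf
  rw [Real.tan_eq_sin_div_cos, h1, h2]
  field_simp
  ring

theorem position_shortProp {t : ℝ} (ht : |t| < Real.pi) (m : Config n) (φ : 𝓢(Config n, ℂ)) :
    position m (shortProp n t φ) =
      shortProp n t ((Real.cos t : ℂ) • position m φ - (Real.sin t : ℂ) • momentum m φ) := by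
  have h1 : (Real.tan (t / 2) * Real.sin t : ℂ) = 1 - Real.cos t := by
    exact_mod_cast tan_half_mul_sin ht
  rw [shortProp_apply, position_chirpMul, position_freeProp, position_chirpMul, momentum_chirpMul,
    ← map_smul, ← map_sub, shortProp_apply]
  congr 3
  linear_combination (norm := module) (-h1) • position m φ

theorem momentum_shortProp {t : ℝ} (ht : |t| < Real.pi) (m : Config n) (φ : 𝓢(Config n, ℂ)) :
    momentum m (shortProp n t φ) =
      shortProp n t ((Real.cos t : ℂ) • momentum m φ + (Real.sin t : ℂ) • position m φ) := by
  have h1 : (Real.tan (t / 2) * Real.sin t : ℂ) = 1 - Real.cos t := by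
    exact_mod_cast tan_half_mul_sin ht
  have h2 : (Real.tan (t / 2) * (1 + Real.cos t) : ℂ) = Real.sin t := by
    exact_mod_cast tan_half_mul_one_add_cos ht
  simp only [shortProp_apply, momentum_chirpMul, momentum_freeProp, position_freeProp,
    position_chirpMul, map_add, map_sub, map_smul]
  linear_combination (norm := module)
    (-h1) • chirpMul n (Real.tan (t / 2)) (freeProp n (Real.sin t)
      (chirpMul n (Real.tan (t / 2)) (momentum m φ))) +
    (h2 - (Real.tan (t / 2) : ℂ) * h1) • chirpMul n (Real.tan (t / 2)) (freeProp n (Real.sin t)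
      (chirpMul n (Real.tan (t / 2)) (position m φ)))

theorem potential_shortProp {t : ℝ} (ht : |t| < Real.pi) (φ : 𝓢(Config n, ℂ)) :
    potential n (shortProp n t φ) = shortProp n t ((1 / 2 : ℂ) • ∑ j : Fin n,
      ((Real.cos t : ℂ) ^ 2 • position (coordDir j) (position (coordDir j) φ) -
        (Real.cos t * Real.sin t : ℂ) • (position (coordDir j) (momentum (coordDir j) φ) +
          momentum (coordDir j) (position (coordDir j) φ)) +
        (Real.sin t : ℂ) ^ 2 • momentum (coordDir j) (momentum (coordDir j) φ))) := by
  rw [potential_eq_sum, map_smul, map_sum]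
  congr 1
  refine Finset.sum_congr rfl fun j _ ↦ ?_
  rw [position_shortProp ht, position_shortProp ht]
  congr 1
  simp only [map_sub, map_smul]
  module

theorem kinetic_shortProp {t : ℝ} (ht : |t| < Real.pi) (φ : 𝓢(Config n, ℂ)) :
    kinetic n (shortProp n t φ) = shortProp n t ((1 / 2 : ℂ) • ∑ j : Fin n,
      ((Real.cos t : ℂ) ^ 2 • momentum (coordDir j) (momentum (coordDir j) φ) +
        (Real.cos t * Real.sin t : ℂ) • (position (coordDir j) (momentum (coordDir j) φ) +
          momentum (coordDir j) (position (coordDir j) φ)) +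
        (Real.sin t : ℂ) ^ 2 • position (coordDir j) (position (coordDir j) φ))) := by
  rw [kinetic_eq_sum, map_smul, map_sum]
  congr 1
  refine Finset.sum_congr rfl fun j _ ↦ ?_
  rw [momentum_shortProp ht, momentum_shortProp ht]
  congr 1
  simp only [map_add, map_smul]
  module

theorem oscillatorSchwartz_shortProp {t : ℝ} (ht : |t| < Real.pi) (φ : 𝓢(Config n, ℂ)) :
    oscillatorSchwartz n (shortProp n t φ) = shortProp n t (oscillatorSchwartz n φ) := by
  have h : (Real.cos t : ℂ) ^ 2 + (Real.sin t : ℂ) ^ 2 = 1 := by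
    exact_mod_cast Real.cos_sq_add_sin_sq t
  rw [oscillatorSchwartz_eq, oscillatorSchwartz_eq, potential_shortProp ht, kinetic_shortProp ht,
    ← map_add, potential_eq_sum, kinetic_eq_sum, ← smul_add, ← smul_add, ← Finset.sum_add_distrib,
    ← Finset.sum_add_distrib]
  congr 2
  refine Finset.sum_congr rfl fun j _ ↦ ?_
  linear_combination (norm := module) h • (position (coordDir j) (position (coordDir j) φ) +
    momentum (coordDir j) (momentum (coordDir j) φ))

/-- The three terms of the product rule for the `t`-derivative of `shortProp`, with the factors
`d/dt tan (t / 2) = (1 + tan² (t / 2)) / 2` and `d/dt sin t = cos t`, add up to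
`shortProp n t (H₀ φ)`. -/
theorem shortProp_generator {t : ℝ} (ht : |t| < Real.pi) (φ : 𝓢(Config n, ℂ)) :
    ((1 / 2 * (1 + Real.tan (t / 2) ^ 2) : ℝ) : ℂ) • potential n (shortProp n t φ) +
      ((Real.cos t : ℂ) • chirpMul n (Real.tan (t / 2)) (freeProp n (Real.sin t)
        (kinetic n (chirpMul n (Real.tan (t / 2)) φ))) +
      ((1 / 2 * (1 + Real.tan (t / 2) ^ 2) : ℝ) : ℂ) • shortProp n t (potential n φ)) =
    shortProp n t (oscillatorSchwartz n φ) := by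
  have hk : kinetic n (chirpMul n (Real.tan (t / 2)) φ) =
      chirpMul n (Real.tan (t / 2)) ((1 / 2 : ℂ) • ∑ j : Fin n,
      (momentum (coordDir j) (momentum (coordDir j) φ) +
        (Real.tan (t / 2) : ℂ) • (position (coordDir j) (momentum (coordDir j) φ) +
          momentum (coordDir j) (position (coordDir j) φ)) +
        (Real.tan (t / 2) : ℂ) ^ 2 • position (coordDir j) (position (coordDir j) φ))) := by
    rw [kinetic_eq_sum, map_smul, map_sum]
    congr 1
    refine Finset.sum_congr rfl fun j _ ↦ ?_
    rw [momentum_chirpMul, momentum_chirpMul]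
    congr 1
    simp only [map_add, map_smul]
    module
  have h1 : (Real.tan (t / 2) * Real.sin t : ℂ) = 1 - Real.cos t := by
    exact_mod_cast tan_half_mul_sin ht
  have h2 : (Real.tan (t / 2) * (1 + Real.cos t) : ℂ) = Real.sin t := by
    exact_mod_cast tan_half_mul_one_add_cos ht
  have h3 : (Real.cos t : ℂ) ^ 2 + (Real.sin t : ℂ) ^ 2 = 1 := by
    exact_mod_cast Real.cos_sq_add_sin_sq t
  -- `(1 + tan² (t / 2)) sin t / 2 = tan (t / 2)`
  have h4 : (1 / 2 * (1 + (Real.tan (t / 2) : ℂ) ^ 2)) * Real.sin t = Real.tan (t / 2) := by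
    linear_combination (1 / 2 * (Real.tan (t / 2) : ℂ)) * h1 - (1 / 2 : ℂ) * h2
  rw [potential_shortProp ht, hk, ← shortProp_apply, ← map_smul, ← map_smul, ← map_smul, ← map_add,
    ← map_add, oscillatorSchwartz_eq, potential_eq_sum, kinetic_eq_sum]
  congr 1
  simp only [smul_comm _ (1 / 2 : ℂ), ← smul_add, Finset.smul_sum (s := Finset.univ),
    ← Finset.sum_add_distrib]
  refine Finset.sum_congr rfl fun j _ ↦ ?_
  simp only [Complex.ofReal_mul, Complex.ofReal_add, Complex.ofReal_pow, Complex.ofReal_one,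
    Complex.ofReal_div, Complex.ofReal_ofNat]
  generalize (Real.tan (t / 2) : ℂ) = a at *
  generalize (Real.sin t : ℂ) = s at *
  generalize (Real.cos t : ℂ) = c at *
  -- the coefficients of `D²`, `x D + D x` and `x²` respectively
  have k1 : 1 / 2 * (1 + a ^ 2) * s ^ 2 + c = 1 := by
    linear_combination s * h4 + h1
  have k2 : -(1 / 2 * (1 + a ^ 2) * (c * s)) + c * a = 0 := by
    linear_combination -c * h4
  have k3 : 1 / 2 * (1 + a ^ 2) * c ^ 2 + c * a ^ 2 + 1 / 2 * (1 + a ^ 2) = 1 := by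
    linear_combination (1 / 2 * (1 + c)) * (a * h2 + h1)
  linear_combination (norm := module) (1 / 2 * k1) • momentum (coordDir j) (momentum (coordDir j) φ) +
    (1 / 2 * k2) • (position (coordDir j) (momentum (coordDir j) φ) +
          momentum (coordDir j) (position (coordDir j) φ)) +
    (1 / 2 * k3) • position (coordDir j) (position (coordDir j) φ)

/-! ### The Schrödinger equation in `L²` -/

/-- The embedding of Schwartz functions into `L²(ℝⁿ)`. -/
abbrev toL2 : 𝓢(Config n, ℂ) →L[ℂ] L2 n := toLpCLM ℂ ℂ 2 volume

theorem toL2_injective : Function.Injective (toL2 (n := n)) :=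
  injective_toLp 2 volume

theorem denseRange_toL2 : DenseRange (toL2 (n := n)) :=
  denseRange_toLpCLM ENNReal.ofNat_ne_top

theorem ofReal_smul_L2 (r : ℝ) (u : L2 n) : (r : ℂ) • u = r • u := algebraMap_smul ℂ r u

theorem norm_toL2_le {φ ψ : 𝓢(Config n, ℂ)} {c : ℝ} (h : ∀ x, ‖φ x‖ ≤ c * ‖ψ x‖) :
    ‖toL2 φ‖ ≤ c * ‖toL2 ψ‖ := by
  refine Lp.norm_le_mul_norm_of_ae_le_mul ?_
  filter_upwards [φ.coeFn_toLp 2 volume, ψ.coeFn_toLp 2 volume] with x h1 h2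
  rw [toLpCLM_apply, toLpCLM_apply, h1, h2]
  exact h x

theorem norm_toL2_chirpMul (a : ℝ) (φ : 𝓢(Config n, ℂ)) :
    ‖toL2 (chirpMul n a φ)‖ = ‖toL2 φ‖ := by
  apply le_antisymm
  · rw [← one_mul ‖toL2 φ‖]
    exact norm_toL2_le fun x ↦ by rw [chirpMul_apply, norm_mul, norm_chirp]
  · rw [← one_mul ‖toL2 (chirpMul n a φ)‖]
    exact norm_toL2_le fun x ↦ by rw [chirpMul_apply, norm_mul, norm_chirp]; simp

theorem norm_toL2_fourier (φ : 𝓢(Config n, ℂ)) : ‖toL2 (𝓕 φ)‖ = ‖toL2 φ‖ :=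
  norm_fourier_toL2_eq φ

theorem norm_toL2_fourierInv (φ : 𝓢(Config n, ℂ)) : ‖toL2 (𝓕⁻ φ)‖ = ‖toL2 φ‖ := by
  rw [← norm_toL2_fourier, fourier_fourierInv_eq]

theorem norm_toL2_freeProp (b : ℝ) (φ : 𝓢(Config n, ℂ)) :
    ‖toL2 (freeProp n b φ)‖ = ‖toL2 φ‖ := by
  rw [freeProp_apply, norm_toL2_fourierInv, norm_toL2_chirpMul, norm_toL2_fourier]

theorem norm_toL2_shortProp (t : ℝ) (φ : 𝓢(Config n, ℂ)) :
    ‖toL2 (shortProp n t φ)‖ = ‖toL2 φ‖ := by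
  rw [shortProp_apply, norm_toL2_chirpMul, norm_toL2_freeProp, norm_toL2_chirpMul]

theorem norm_cexp_sub_one_sub_le (θ : ℝ) :
    ‖Complex.exp (θ * Complex.I) - 1 - θ * Complex.I‖ ≤ 3 * θ ^ 2 := by
  have hn : ‖(θ : ℂ) * Complex.I‖ = |θ| := by simp
  rcases le_total |θ| 1 with h | h
  · refine (Complex.norm_exp_sub_one_sub_id_le (hn.trans_le h)).trans ?_
    rw [hn, sq_abs]
    nlinarith [sq_nonneg θ]
  · calc ‖Complex.exp (θ * Complex.I) - 1 - θ * Complex.I‖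
        ≤ ‖Complex.exp (θ * Complex.I)‖ + ‖(1 : ℂ)‖ + ‖(θ : ℂ) * Complex.I‖ :=
          (norm_sub_le _ _).trans (add_le_add_left (norm_sub_le _ _) _)
      _ = 2 + |θ| := by rw [Complex.norm_exp_ofReal_mul_I, hn, norm_one]; ring
      _ ≤ 3 * θ ^ 2 := by rw [← sq_abs]; nlinarith

/-- A quadratic bound on the remainder gives differentiability. -/
theorem hasDerivAt_of_norm_le_sq {E : Type*} [NormedAddCommGroup E] [NormedSpace ℝ E]
    {f : ℝ → E} {f' : E} {x C : ℝ}
    (h : ∀ᶠ y in 𝓝 x, ‖f y - f x - (y - x) • f'‖ ≤ C * (y - x) ^ 2) : HasDerivAt f f' x := by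
  rw [hasDerivAt_iff_isLittleO]
  have h1 : (fun y ↦ f y - f x - (y - x) • f') =O[𝓝 x] fun y ↦ (y - x) ^ 2 := by
    refine Asymptotics.IsBigO.of_bound C ?_
    filter_upwards [h] with y hy
    rwa [Real.norm_of_nonneg (sq_nonneg _)]
  refine h1.trans_isLittleO ?_
  have h2 : Tendsto (fun y : ℝ ↦ y - x) (𝓝 x) (𝓝 0) := by
    have : ContinuousAt (fun y : ℝ ↦ y - x) x := by fun_prop
    simpa [ContinuousAt] using this
  exact (Asymptotics.isLittleO_pow_id one_lt_two).comp_tendsto h2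

theorem hasDerivAt_toL2_chirpMul (a : ℝ) (φ : 𝓢(Config n, ℂ)) :
    HasDerivAt (fun a ↦ toL2 (chirpMul n a φ))
      (Complex.I • toL2 (potential n (chirpMul n a φ))) a := by
  refine hasDerivAt_of_norm_le_sq (C := 3 * ‖toL2 (potential n (potential n φ))‖)
    (Eventually.of_forall fun b ↦ ?_)
  have h1 : toL2 (chirpMul n b φ) - toL2 (chirpMul n a φ) -
      (b - a) • Complex.I • toL2 (potential n (chirpMul n a φ)) =
      toL2 (chirpMul n b φ - chirpMul n a φ -
        ((b - a : ℝ) : ℂ) • Complex.I • potential n (chirpMul n a φ)) := by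
    rw [← ofReal_smul_L2 (b - a)]
    simp only [map_sub, map_smul]
  rw [h1, mul_right_comm]
  refine norm_toL2_le fun x ↦ ?_
  have h2 : (chirpMul n b φ - chirpMul n a φ -
        ((b - a : ℝ) : ℂ) • Complex.I • potential n (chirpMul n a φ)) x =
      (Complex.exp ((((b - a) * (1 / 2 * ‖x‖ ^ 2) : ℝ) : ℂ) * Complex.I) - 1 -
        (((b - a) * (1 / 2 * ‖x‖ ^ 2) : ℝ) : ℂ) * Complex.I) * (chirp n a x * φ x) := by
    have h3 : chirp n b x = Complex.exp ((((b - a) * (1 / 2 * ‖x‖ ^ 2) : ℝ) : ℂ) * Complex.I) *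
        chirp n a x := by
      rw [chirp, chirp, ← Complex.exp_add]
      congr 1
      push_cast
      ring
    simp only [_root_.sub_apply, _root_.smul_apply, chirpMul_apply, potential_apply, h3,
      smul_eq_mul]
    push_cast
    ring
  rw [h2, norm_mul, norm_mul, norm_chirp, one_mul, potential_apply, potential_apply, norm_mul,
    norm_mul, Complex.norm_real, Real.norm_of_nonneg (by positivity)]
  calc _ ≤ 3 * ((b - a) * (1 / 2 * ‖x‖ ^ 2)) ^ 2 * ‖φ x‖ := by
        gcongr; exact norm_cexp_sub_one_sub_le _
    _ = _ := by ring

theorem kinetic_fourierInv (φ : 𝓢(Config n, ℂ)) :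
    kinetic n (𝓕⁻ φ) = ((2 * Real.pi) ^ 2 : ℂ) • 𝓕⁻ (potential n φ) := by
  have h (ψ : Fin n → 𝓢(Config n, ℂ)) : (𝓕⁻ (∑ j, ψ j) : 𝓢(Config n, ℂ)) =
      ∑ j, (𝓕⁻ (ψ j) : 𝓢(Config n, ℂ)) :=
    map_sum (fourierInvCLM ℂ 𝓢(Config n, ℂ)) ψ Finset.univ
  rw [kinetic_eq_sum, potential_eq_sum, FourierTransform.fourierInv_smul, h,
    smul_comm _ (1 / 2 : ℂ), Finset.smul_sum (r := ((2 * Real.pi) ^ 2 : ℂ))]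
  congr 1
  refine Finset.sum_congr rfl fun j _ ↦ ?_
  rw [momentum_fourierInv, momentum_fourierInv, map_smul, smul_smul,
    FourierTransform.fourierInv_smul, sq]

theorem kinetic_freeProp (b : ℝ) (φ : 𝓢(Config n, ℂ)) :
    kinetic n (freeProp n b φ) = freeProp n b (kinetic n φ) := by
  simp only [kinetic_eq_sum, momentum_freeProp, map_smul, map_sum]

theorem hasDerivAt_toL2_freeProp (b : ℝ) (φ : 𝓢(Config n, ℂ)) :
    HasDerivAt (fun b ↦ toL2 (freeProp n b φ))
      (Complex.I • toL2 (freeProp n b (kinetic n φ))) b := by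
  let L : L2 n →L[ℝ] L2 n :=
    ContinuousLinearMap.restrictScalars ℝ
      (Lp.fourierTransformₗᵢ (Config n) ℂ).symm.toContinuousLinearEquiv.toContinuousLinearMap
  have hL (ψ : 𝓢(Config n, ℂ)) : L (toL2 ψ) = toL2 (𝓕⁻ ψ) := toLp_fourierInv_eq ψ
  have hs : HasDerivAt (fun b : ℝ ↦ (2 * Real.pi) ^ 2 * b) ((2 * Real.pi) ^ 2) b := by
    simpa using (hasDerivAt_id b).const_mul ((2 * Real.pi) ^ 2)
  have h := L.hasFDerivAt.comp_hasDerivAt b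
    ((hasDerivAt_toL2_chirpMul ((2 * Real.pi) ^ 2 * b) (𝓕 φ)).scomp b hs)
  have h1 : (L ∘ (fun a ↦ toL2 (chirpMul n a (𝓕 φ))) ∘ fun b : ℝ ↦ (2 * Real.pi) ^ 2 * b) =
      fun b ↦ toL2 (freeProp n b φ) := funext fun b ↦ hL _
  rw [h1] at h
  refine h.congr_deriv ?_
  rw [← kinetic_freeProp, freeProp_apply, kinetic_fourierInv, ← ofReal_smul_L2, ← map_smul,
    ← map_smul, hL, FourierTransform.fourierInv_smul, FourierTransform.fourierInv_smul, ← map_smul,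
    smul_comm]
  push_cast
  rfl

/-- The product rule for an isometric family of operators applied to a moving vector. -/
theorem hasDerivAt_toL2_apply {A : ℝ → 𝓢(Config n, ℂ) →L[ℂ] 𝓢(Config n, ℂ)}
    (hA : ∀ t φ, ‖toL2 (A t φ)‖ = ‖toL2 φ‖) {ψ : ℝ → 𝓢(Config n, ℂ)} {ψ' : 𝓢(Config n, ℂ)}
    {v : L2 n} {t : ℝ} (hψ : HasDerivAt (fun t ↦ toL2 (ψ t)) (toL2 ψ') t)
    (hv : HasDerivAt (fun s ↦ toL2 (A s (ψ t))) v t)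
    (hc : ContinuousAt (fun s ↦ toL2 (A s ψ')) t) :
    HasDerivAt (fun s ↦ toL2 (A s (ψ s))) (v + toL2 (A t ψ')) t := by
  have key : HasDerivAt (fun s ↦ toL2 (A s (ψ s - ψ t))) (toL2 (A t ψ')) t := by
    rw [hasDerivAt_iff_isLittleO] at hψ ⊢
    have e : (fun s ↦ toL2 (A s (ψ s - ψ t)) - toL2 (A t (ψ t - ψ t)) - (s - t) • toL2 (A t ψ')) =
        fun s ↦ toL2 (A s (ψ s - ψ t - ((s - t : ℝ) : ℂ) • ψ')) +
          (s - t) • (toL2 (A s ψ') - toL2 (A t ψ')) := by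
      funext s
      rw [← ofReal_smul_L2 (s - t), ← ofReal_smul_L2 (s - t)]
      simp only [sub_self, map_zero, sub_zero, map_sub, map_smul, smul_sub]
      abel
    rw [e]
    refine Asymptotics.IsLittleO.add ?_ ?_
    · refine Asymptotics.IsLittleO.of_norm_left (hψ.norm_left.congr_left fun s ↦ ?_)
      rw [hA, ← ofReal_smul_L2 (s - t), map_sub, map_sub, map_smul]
    · have h0 : (fun s ↦ toL2 (A s ψ') - toL2 (A t ψ')) =o[𝓝 t] fun _ ↦ (1 : ℝ) := by
        rw [Asymptotics.isLittleO_one_iff]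
        simpa using hc.sub_const (toL2 (A t ψ'))
      simpa using (Asymptotics.isBigO_refl (fun s ↦ s - t) (𝓝 t)).smul_isLittleO h0
  have h := hv.add key
  refine h.congr_of_eventuallyEq (Eventually.of_forall fun s ↦ ?_)
  simp only [Pi.add_apply, map_sub, add_sub_cancel]

theorem hasDerivAt_tan_half {t : ℝ} (ht : |t| < Real.pi) :
    HasDerivAt (fun t ↦ Real.tan (t / 2)) (1 / 2 * (1 + Real.tan (t / 2) ^ 2)) t := by
  have hc := cos_half_ne_zero ht
  have h := (Real.hasDerivAt_tan hc).comp t ((hasDerivAt_id t).div_const 2)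
  refine h.congr_deriv ?_
  rw [Real.tan_eq_sin_div_cos, div_pow]
  field_simp
  rw [Real.cos_sq_add_sin_sq]

/-- `shortProp` solves the Schrödinger equation. -/
theorem hasDerivAt_toL2_shortProp {t : ℝ} (ht : |t| < Real.pi) (φ : 𝓢(Config n, ℂ)) :
    HasDerivAt (fun t ↦ toL2 (shortProp n t φ))
      (Complex.I • toL2 (oscillatorSchwartz n (shortProp n t φ))) t := by
  have hchirp (ψ : 𝓢(Config n, ℂ)) :=
    (hasDerivAt_toL2_chirpMul (Real.tan (t / 2)) ψ).scomp t (hasDerivAt_tan_half ht)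
  have hfree (ψ : 𝓢(Config n, ℂ)) :=
    (hasDerivAt_toL2_freeProp (Real.sin t) ψ).scomp t (Real.hasDerivAt_sin t)
  simp only [← ofReal_smul_L2, ← toL2.map_smul] at hchirp hfree
  have h1 := hasDerivAt_toL2_apply (A := fun t ↦ freeProp n (Real.sin t))
    (fun _ _ ↦ norm_toL2_freeProp _ _) (hchirp φ) (hfree _) (hfree _).continuousAt
  rw [← map_add] at h1
  have h2 := hasDerivAt_toL2_apply (A := fun t ↦ chirpMul n (Real.tan (t / 2)))
    (fun _ _ ↦ norm_toL2_chirpMul _ _) h1 (hchirp _) (hchirp _).continuousAt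
  refine h2.congr_deriv ?_
  rw [oscillatorSchwartz_shortProp ht, ← shortProp_generator ht, ← map_add, ← map_smul]
  have hp : potential n (chirpMul n (Real.tan (t / 2)) φ) =
      chirpMul n (Real.tan (t / 2)) (potential n φ) := by
    simp only [potential_eq_sum, position_chirpMul, map_smul, map_sum]
  simp only [shortProp_apply, hp, map_add, map_smul]
  module

/-- If `Re ⟪w, w'⟫ = 0` along a curve that vanishes somewhere, then it vanishes everywhere, because
its norm is constant. -/
theorem eq_zero_of_inner_deriv_eq_zero {E : Type*} [NormedAddCommGroup E] [InnerProductSpace ℂ E]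
    {w w' : ℝ → E} {s : Set ℝ} (hs : Convex ℝ s)
    (hw : ∀ t ∈ s, HasDerivAt w (w' t) t)
    (h : ∀ t ∈ s, inner ℂ (w t) (w' t) + inner ℂ (w' t) (w t) = 0) {t₀ t : ℝ} (ht₀ : t₀ ∈ s)
    (h0 : w t₀ = 0) (ht : t ∈ s) : w t = 0 := by
  have hd (r : ℝ) (hr : r ∈ s) : HasDerivWithinAt (fun r ↦ inner ℂ (w r) (w r)) (0 : ℂ) s r := by
    rw [← h r hr]
    exact ((hw r hr).inner ℂ (hw r hr)).hasDerivWithinAt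
  have := hs.norm_image_sub_le_of_norm_hasDerivWithin_le (C := 0) hd (by simp) ht₀ ht
  simpa [h0] using this

/-- `i H₀` is skew-symmetric on Schwartz space, because `shortProp` is isometric. -/
theorem inner_oscillatorSchwartz (φ : 𝓢(Config n, ℂ)) :
    inner ℂ (toL2 φ) (Complex.I • toL2 (oscillatorSchwartz n φ)) +
      inner ℂ (Complex.I • toL2 (oscillatorSchwartz n φ)) (toL2 φ) = 0 := by
  have h1 := hasDerivAt_toL2_shortProp (n := n) (t := 0) (by simp [Real.pi_pos]) φ
  have h2 := h1.inner ℂ h1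
  have h3 (t : ℝ) : inner ℂ (toL2 (shortProp n t φ)) (toL2 (shortProp n t φ)) =
      inner ℂ (toL2 φ) (toL2 φ) := by
    simp only [inner_self_eq_norm_sq_to_K, norm_toL2_shortProp]
  simp only [shortProp_zero, h3] at h2
  exact h2.unique (hasDerivAt_const _ _)

/-- The local group law: both sides solve the Schrödinger equation in `s`. -/
theorem shortProp_add {s t : ℝ} (hs : |s| ≤ 1) (ht : |t| ≤ 1) (φ : 𝓢(Config n, ℂ)) :
    shortProp n (s + t) φ = shortProp n s (shortProp n t φ) := by
  have hpi := Real.pi_gt_three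
  apply toL2_injective
  rw [← sub_eq_zero, ← map_sub]
  refine eq_zero_of_inner_deriv_eq_zero (s := Set.Icc (-1) 1) (t₀ := 0) (convex_Icc _ _)
    (w := fun r ↦ toL2 (shortProp n (r + t) φ - shortProp n r (shortProp n t φ)))
    (w' := fun r ↦ Complex.I • toL2 (oscillatorSchwartz n
      (shortProp n (r + t) φ - shortProp n r (shortProp n t φ)))) ?_ ?_ (by simp) ?_ (abs_le.1 hs)
  · intro r hr
    have hr' : |r| ≤ 1 := abs_le.2 hr
    have h1 := (hasDerivAt_toL2_shortProp (n := n) (t := r + t)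
      (by have := abs_add_le r t; linarith) φ).comp_add_const r t
    have h2 := hasDerivAt_toL2_shortProp (n := n) (t := r) (by linarith) (shortProp n t φ)
    have h3 := h1.sub h2
    rw [← smul_sub, ← map_sub, ← map_sub] at h3
    exact h3.congr_of_eventuallyEq (Eventually.of_forall fun r ↦ map_sub _ _ _)
  · intro r _
    exact inner_oscillatorSchwartz _
  · rw [zero_add, shortProp_zero, sub_self, map_zero]

/-! ### From a local to a global one-parameter group -/

/-- The extension to `ℝ` of a one-parameter group `S` given on `[-1, 1]`. -/
def extendGroupHom {G : Type*} [Group G] (S : ℝ → G) (t : ℝ) : G := S 1 ^ ⌊t⌋ * S (Int.fract t)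

section ExtendGroupHom

variable {G : Type*} [Group G] {S : ℝ → G}

/-- The defining formula does not depend on the choice of the integral part. -/
theorem extendGroupHom_int_add (hS : ∀ s t, |s| ≤ 1 → |t| ≤ 1 → S (s + t) = S s * S t) (k : ℤ)
    {r : ℝ} (hr : |r| ≤ 1) : extendGroupHom S (k + r) = S 1 ^ k * S r := by
  have h0 : S 0 = 1 := by simpa using hS 0 0
  have h01 (k : ℤ) {r : ℝ} (h0 : 0 ≤ r) (h1 : r < 1) :
      extendGroupHom S (k + r) = S 1 ^ k * S r := by
    rw [extendGroupHom, Int.floor_intCast_add, Int.fract_intCast_add, Int.fract_eq_self.2 ⟨h0, h1⟩,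
      Int.floor_eq_zero_iff.2 ⟨h0, h1⟩, add_zero]
  obtain ⟨h1, h2⟩ := abs_le.1 hr
  rcases lt_or_ge r 0 with h | h
  · have := h01 (k - 1) (r := 1 + r) (by linarith) (by linarith)
    push_cast at this
    rw [hS 1 r (by simp) hr, ← mul_assoc, ← zpow_add_one, sub_add_cancel,
      show (k : ℝ) - 1 + (1 + r) = k + r by ring] at this
    exact this
  · rcases h2.lt_or_eq with h' | rfl
    · exact h01 k h h'
    · have := h01 (k + 1) (r := 0) le_rfl one_pos
      push_cast at this
      rwa [add_zero, h0, mul_one, zpow_add_one] at this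

theorem extendGroupHom_of_abs_le
    (hS : ∀ s t, |s| ≤ 1 → |t| ≤ 1 → S (s + t) = S s * S t) {t : ℝ} (ht : |t| ≤ 1) :
    extendGroupHom S t = S t := by
  simpa using extendGroupHom_int_add hS 0 ht

theorem extendGroupHom_add (hS : ∀ s t, |s| ≤ 1 → |t| ≤ 1 → S (s + t) = S s * S t) (s t : ℝ) :
    extendGroupHom S (s + t) = extendGroupHom S s * extendGroupHom S t := by
  have hf (s : ℝ) : |Int.fract s| ≤ 1 := by
    rw [abs_of_nonneg (Int.fract_nonneg s)]; exact (Int.fract_lt_one s).le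
  have hc : Commute (S (Int.fract s)) (S 1) := by
    rw [Commute, SemiconjBy, ← hS _ _ (hf s) (by simp), ← hS _ _ (by simp) (hf s), add_comm]
  have e : extendGroupHom S s * extendGroupHom S t =
      S 1 ^ (⌊s⌋ + ⌊t⌋) * S (Int.fract s + Int.fract t) := by
    rw [extendGroupHom, extendGroupHom, hS _ _ (hf s) (hf t), zpow_add, mul_assoc, mul_assoc,
      ← mul_assoc (S (Int.fract s)), (hc.zpow_right ⌊t⌋).eq, mul_assoc]
  have hs := Int.floor_add_fract s
  have ht := Int.floor_add_fract t
  have s0 := Int.fract_nonneg s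
  have t0 := Int.fract_nonneg t
  have s1 := Int.fract_lt_one s
  have t1 := Int.fract_lt_one t
  rw [e]
  rcases le_total (Int.fract s + Int.fract t) 1 with h | h
  · rw [← extendGroupHom_int_add hS _ (abs_le.2 ⟨by linarith, h⟩)]
    congr 1
    push_cast
    linarith
  · have h' : |Int.fract s + Int.fract t - 1| ≤ 1 := abs_le.2 ⟨by linarith, by linarith⟩
    have e2 := hS 1 (Int.fract s + Int.fract t - 1) (by simp) h'
    rw [add_sub_cancel] at e2
    rw [e2, ← mul_assoc, ← zpow_add_one, ← extendGroupHom_int_add hS _ h']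
    congr 1
    push_cast
    linarith

end ExtendGroupHom

/-- A property of real numbers that is stable under addition and holds near `0` holds everywhere. -/
theorem real_induction_add {P : ℝ → Prop} (h1 : ∀ t, |t| ≤ 1 → P t)
    (h2 : ∀ s t, P s → P t → P (s + t)) (t : ℝ) : P t := by
  have h (k : ℕ) : ∀ t : ℝ, |t| ≤ k + 1 → P t := by
    induction k with
    | zero => simpa using h1
    | succ k ih =>
      intro t ht
      push_cast at ht
      have hk : (0 : ℝ) < k + 1 + 1 := by positivity
      have hb : |t / (k + 1 + 1)| ≤ 1 := by
        rw [abs_div, abs_of_pos hk, div_le_one hk]; exact ht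
      have e : t = t / (k + 1 + 1) * (k + 1) + t / (k + 1 + 1) := by field_simp
      rw [e]
      refine h2 _ _ (ih _ ?_) (h1 _ hb)
      rw [abs_mul, abs_of_pos (show (0 : ℝ) < k + 1 by positivity)]
      exact mul_le_of_le_one_left (by positivity) hb
  obtain ⟨k, hk⟩ := exists_nat_ge |t|
  exact h k t (by linarith)

/-- `shortProp` as an automorphism of Schwartz space. -/
def shortPropEquiv (n : ℕ) (t : ℝ) : 𝓢(Config n, ℂ) ≃L[ℂ] 𝓢(Config n, ℂ) :=
  ContinuousLinearEquiv.equivOfInverse (shortProp n t) (shortProp n (-t)) (shortProp_neg_apply t)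
    fun φ ↦ by simpa using shortProp_neg_apply (-t) φ

/-- The group `e^{i t H₀}` on Schwartz space. -/
def schwartzGroup (n : ℕ) : ℝ → 𝓢(Config n, ℂ) ≃L[ℂ] 𝓢(Config n, ℂ) :=
  extendGroupHom (shortPropEquiv n)

theorem shortPropEquiv_add (s t : ℝ) (hs : |s| ≤ 1) (ht : |t| ≤ 1) :
    shortPropEquiv n (s + t) = shortPropEquiv n s * shortPropEquiv n t :=
  ContinuousLinearEquiv.ext (funext fun φ ↦ shortProp_add hs ht φ)

theorem schwartzGroup_of_abs_le {t : ℝ} (ht : |t| ≤ 1) (φ : 𝓢(Config n, ℂ)) :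
    schwartzGroup n t φ = shortProp n t φ := by
  rw [schwartzGroup, extendGroupHom_of_abs_le shortPropEquiv_add ht]
  rfl

theorem schwartzGroup_add (s t : ℝ) (φ : 𝓢(Config n, ℂ)) :
    schwartzGroup n (s + t) φ = schwartzGroup n s (schwartzGroup n t φ) := by
  rw [schwartzGroup, extendGroupHom_add shortPropEquiv_add s t]
  rfl

theorem schwartzGroup_zero (φ : 𝓢(Config n, ℂ)) : schwartzGroup n 0 φ = φ := by
  rw [schwartzGroup_of_abs_le (by simp), shortProp_zero]

theorem norm_toL2_schwartzGroup (t : ℝ) (φ : 𝓢(Config n, ℂ)) :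
    ‖toL2 (schwartzGroup n t φ)‖ = ‖toL2 φ‖ := by
  revert φ
  refine real_induction_add (P := fun t ↦ ∀ φ, ‖toL2 (schwartzGroup n t φ)‖ = ‖toL2 φ‖)
    (fun t ht φ ↦ ?_) (fun s t hs ht φ ↦ ?_) t
  · rw [schwartzGroup_of_abs_le ht, norm_toL2_shortProp]
  · rw [schwartzGroup_add, hs, ht]

/-- `e^{i t H₀}` solves the Schrödinger equation on Schwartz space. -/
theorem hasDerivAt_toL2_schwartzGroup (t : ℝ) (φ : 𝓢(Config n, ℂ)) :
    HasDerivAt (fun t ↦ toL2 (schwartzGroup n t φ))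
      (Complex.I • toL2 (oscillatorSchwartz n (schwartzGroup n t φ))) t := by
  have h := hasDerivAt_toL2_shortProp (n := n) (t := t - t) (by simp [Real.pi_pos])
    (schwartzGroup n t φ)
  have h1 := h.comp_sub_const t t
  rw [sub_self, shortProp_zero] at h1
  refine h1.congr_of_eventuallyEq ?_
  filter_upwards [Metric.ball_mem_nhds t one_pos] with s hs
  rw [Metric.mem_ball, Real.dist_eq] at hs
  rw [← schwartzGroup_of_abs_le hs.le, ← schwartzGroup_add, sub_add_cancel]

/-! ### The unitary group on `L²` -/

theorem fourierInv_eq_fourier_neg (φ : 𝓢(Config n, ℂ)) :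
    𝓕⁻ φ = 𝓕 (compCLMOfContinuousLinearEquiv ℂ (ContinuousLinearEquiv.neg ℝ (M := Config n))
      φ) := by
  have h : (𝓕 (𝓕⁻ (𝓕⁻ φ : 𝓢(Config n, ℂ)) : 𝓢(Config n, ℂ)) : 𝓢(Config n, ℂ)) = 𝓕⁻ φ :=
    fourier_fourierInv_eq _
  have e : 𝓕⁻ (𝓕⁻ φ : 𝓢(Config n, ℂ)) = compCLMOfContinuousLinearEquiv ℂ
      (ContinuousLinearEquiv.neg ℝ (M := Config n)) φ := by
    rw [fourierInv_apply_eq (𝓕⁻ φ), fourier_fourierInv_eq]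
    rfl
  rw [← e, h]

/-- Fourier multipliers with even symbols do not distinguish the Fourier transform from its
inverse. -/
theorem fourier_chirpMul_fourierInv (a : ℝ) (φ : 𝓢(Config n, ℂ)) :
    𝓕 (chirpMul n a (𝓕⁻ φ)) = 𝓕⁻ (chirpMul n a (𝓕 φ)) := by
  rw [fourierInv_eq_fourier_neg (chirpMul n a (𝓕 φ)), fourierInv_apply_eq]
  congr 1
  ext x
  simp [chirpMul_apply, chirp]

theorem integral_freeProp_mul (b : ℝ) (φ ψ : 𝓢(Config n, ℂ)) :
    ∫ x, freeProp n b φ x * ψ x = ∫ x, φ x * freeProp n b ψ x := by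
  rw [freeProp_apply, integral_fourierInv_mul_eq]
  have h (x : Config n) : chirpMul n ((2 * Real.pi) ^ 2 * b) (𝓕 φ) x * 𝓕⁻ ψ x =
      𝓕 φ x * chirpMul n ((2 * Real.pi) ^ 2 * b) (𝓕⁻ ψ) x := by
    simp only [chirpMul_apply]; ring
  simp only [h]
  rw [integral_fourier_mul_eq, fourier_chirpMul_fourierInv, freeProp_apply]

theorem integral_chirpMul_mul (a : ℝ) (φ ψ : 𝓢(Config n, ℂ)) :
    ∫ x, chirpMul n a φ x * ψ x = ∫ x, φ x * chirpMul n a ψ x := by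
  congr 1 with x
  simp only [chirpMul_apply]
  ring

/-- The propagator is symmetric for the bilinear pairing, because `H₀` is real. -/
theorem integral_schwartzGroup_mul (t : ℝ) (φ ψ : 𝓢(Config n, ℂ)) :
    ∫ x, schwartzGroup n t φ x * ψ x = ∫ x, φ x * schwartzGroup n t ψ x := by
  revert φ ψ
  refine real_induction_add (P := fun t ↦ ∀ φ ψ : 𝓢(Config n, ℂ),
    ∫ x, schwartzGroup n t φ x * ψ x = ∫ x, φ x * schwartzGroup n t ψ x)
    (fun t ht φ ψ ↦ ?_) (fun s t hs ht φ ψ ↦ ?_) t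
  · rw [schwartzGroup_of_abs_le ht, schwartzGroup_of_abs_le ht, shortProp_apply,
      integral_chirpMul_mul, integral_freeProp_mul, integral_chirpMul_mul, shortProp_apply]
  · rw [schwartzGroup_add, hs, ht, add_comm, schwartzGroup_add]

/-- The bilinear pairing `(u, v) ↦ ∫ u v` on `L²`. -/
def pairing (n : ℕ) : L2 n →L[ℂ] L2 n →L[ℂ] ℂ :=
  (ContinuousLinearMap.mul ℂ ℂ).lpPairing volume 2 2

theorem toTemperedDistribution_eq_pairing (u : L2 n) (φ : 𝓢(Config n, ℂ)) :
    (u : 𝓢'(Config n, ℂ)) φ = pairing n u (toL2 φ) := by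
  rw [pairing, ContinuousLinearMap.lpPairing_eq_integral, Lp.toTemperedDistribution_apply]
  refine integral_congr_ae ?_
  filter_upwards [φ.coeFn_toLp 2 volume] with x hx
  rw [toLpCLM_apply, hx]
  simp [mul_comm]

theorem pairing_toL2_toL2 (φ ψ : 𝓢(Config n, ℂ)) :
    pairing n (toL2 φ) (toL2 ψ) = ∫ x, φ x * ψ x := by
  rw [pairing, ContinuousLinearMap.lpPairing_eq_integral]
  refine integral_congr_ae ?_
  filter_upwards [φ.coeFn_toLp 2 volume, ψ.coeFn_toLp 2 volume] with x hx hx'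
  rw [toLpCLM_apply, toLpCLM_apply, hx, hx']
  rfl

theorem eq_of_pairing_eq {u v : L2 n}
    (h : ∀ φ : 𝓢(Config n, ℂ), pairing n u (toL2 φ) = pairing n v (toL2 φ)) : u = v := by
  have hk := Lp.ker_toTemperedDistributionCLM_eq_bot (F := ℂ)
    (μ := (volume : Measure (Config n))) (p := 2)
  refine LinearMap.ker_eq_bot.1 hk ?_
  ext φ
  exact (toTemperedDistribution_eq_pairing u φ).trans
    ((h φ).trans (toTemperedDistribution_eq_pairing v φ).symm)

theorem mem_graph_iff_pairing (u v : L2 n) :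
    (u, v) ∈ (harmonicOscillator n).graph ↔ ∀ φ : 𝓢(Config n, ℂ),
      pairing n u (toL2 (oscillatorSchwartz n φ)) = pairing n v (toL2 φ) := by
  rw [mem_graph_harmonicOscillator]
  simp only [← toTemperedDistribution_eq_pairing, ← oscillatorDistribution_apply]
  exact ⟨fun h φ ↦ by rw [h], fun h ↦ by ext φ; exact h φ⟩

/-- The unitary operator `e^{i t H₀}`, the continuous extension of `schwartzGroup n t`. -/
def unitaryGroup (n : ℕ) (t : ℝ) : L2 n ≃ₗᵢ[ℂ] L2 n :=
  (schwartzGroup n t).toLinearEquiv.extendOfIsometry toL2.toLinearMap toL2.toLinearMap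
    denseRange_toL2 denseRange_toL2 (norm_toL2_schwartzGroup t)

theorem unitaryGroup_toL2 (t : ℝ) (φ : 𝓢(Config n, ℂ)) :
    unitaryGroup n t (toL2 φ) = toL2 (schwartzGroup n t φ) :=
  (schwartzGroup n t).toLinearEquiv.extendOfIsometry_eq toL2.toLinearMap toL2.toLinearMap
    denseRange_toL2 denseRange_toL2 (norm_toL2_schwartzGroup t) φ

theorem unitaryGroup_zero (u : L2 n) : unitaryGroup n 0 u = u := by
  refine denseRange_toL2.induction_on u
    (isClosed_eq (unitaryGroup n 0).continuous continuous_id) fun φ ↦ ?_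
  rw [unitaryGroup_toL2, schwartzGroup_zero]

theorem unitaryGroup_add (s t : ℝ) (u : L2 n) :
    unitaryGroup n (s + t) u = unitaryGroup n s (unitaryGroup n t u) := by
  refine denseRange_toL2.induction_on u (isClosed_eq (unitaryGroup n (s + t)).continuous
    ((unitaryGroup n s).continuous.comp (unitaryGroup n t).continuous)) fun φ ↦ ?_
  rw [unitaryGroup_toL2, unitaryGroup_toL2, unitaryGroup_toL2, schwartzGroup_add]

theorem continuous_unitaryGroup (u : L2 n) : Continuous fun t ↦ unitaryGroup n t u := by
  refine continuous_of_uniform_approx_of_continuous fun V hV ↦ ?_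
  obtain ⟨ε, hε, hV⟩ := Metric.mem_uniformity_dist.1 hV
  obtain ⟨φ, hφ⟩ := denseRange_toL2.exists_dist_lt u hε
  refine ⟨fun t ↦ toL2 (schwartzGroup n t φ), ?_, fun t ↦ hV ?_⟩
  · exact continuous_iff_continuousAt.2 fun t ↦ (hasDerivAt_toL2_schwartzGroup t φ).continuousAt
  · beta_reduce
    rw [← unitaryGroup_toL2, LinearIsometryEquiv.dist_map]
    exact hφ

theorem pairing_unitaryGroup (t : ℝ) (u : L2 n) (φ : 𝓢(Config n, ℂ)) :
    pairing n (unitaryGroup n t u) (toL2 φ) = pairing n u (toL2 (schwartzGroup n t φ)) := by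
  refine denseRange_toL2.induction_on u (isClosed_eq (by fun_prop) (by fun_prop)) fun ψ ↦ ?_
  rw [unitaryGroup_toL2, pairing_toL2_toL2, pairing_toL2_toL2, integral_schwartzGroup_mul]

theorem hasDerivAt_pairing_schwartzGroup (u : L2 n) (t : ℝ) (φ : 𝓢(Config n, ℂ)) :
    HasDerivAt (fun t ↦ pairing n u (toL2 (schwartzGroup n t φ)))
      (Complex.I * pairing n u (toL2 (oscillatorSchwartz n (schwartzGroup n t φ)))) t := by
  have h := ((pairing n u).restrictScalars ℝ).hasFDerivAt.comp_hasDerivAt t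
    (hasDerivAt_toL2_schwartzGroup t φ)
  refine h.congr_deriv ?_
  exact (pairing n u).map_smul _ _

theorem hasDerivAt_pairing_left {w : ℝ → L2 n} {w' : L2 n} {t : ℝ} (h : HasDerivAt w w' t)
    (v : L2 n) : HasDerivAt (fun t ↦ pairing n (w t) v) (pairing n w' v) t :=
  (((pairing n).flip v).restrictScalars ℝ).hasFDerivAt.comp_hasDerivAt t h

/-- If `H₀ u = v` in the sense of distributions, then `e^{itH₀} u` is differentiable. -/
theorem hasDerivAt_unitaryGroup {u v : L2 n} (h : (u, v) ∈ (harmonicOscillator n).graph) :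
    HasDerivAt (fun t ↦ unitaryGroup n t u) (Complex.I • v) 0 := by
  rw [mem_graph_iff_pairing] at h
  have hc : Continuous fun s ↦ Complex.I • unitaryGroup n s v :=
    (continuous_unitaryGroup v).const_smul Complex.I
  have hI (t : ℝ) : HasDerivAt (fun t ↦ ∫ s in (0 : ℝ)..t, Complex.I • unitaryGroup n s v)
      (Complex.I • unitaryGroup n t v) t := hc.integral_hasStrictDerivAt 0 t |>.hasDerivAt
  -- the two sides have the same derivative when paired with a Schwartz function
  have key (t : ℝ) :
      unitaryGroup n t u = u + ∫ s in (0 : ℝ)..t, Complex.I • unitaryGroup n s v := by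
    refine eq_of_pairing_eq fun φ ↦ ?_
    have hd (t : ℝ) : HasDerivAt (fun t ↦ pairing n (unitaryGroup n t u) (toL2 φ) -
        pairing n (∫ s in (0 : ℝ)..t, Complex.I • unitaryGroup n s v) (toL2 φ)) 0 t := by
      have h1 := hasDerivAt_pairing_schwartzGroup u t φ
      have h2 := hasDerivAt_pairing_left (hI t) (toL2 φ)
      rw [h] at h1
      rw [map_smul, _root_.smul_apply, smul_eq_mul] at h2
      simp only [← pairing_unitaryGroup] at h1
      have h3 := h1.sub h2
      rw [sub_self] at h3
      exact h3
    have hconst := is_const_of_deriv_eq_zero (fun t ↦ (hd t).differentiableAt)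
      (fun t ↦ (hd t).deriv) t 0
    simp only [unitaryGroup_zero, intervalIntegral.integral_same, map_zero,
      _root_.zero_apply, sub_zero] at hconst
    rw [map_add, _root_.add_apply, ← hconst, sub_add_cancel]
  have h0 := (hI 0).const_add u
  rw [unitaryGroup_zero] at h0
  exact h0.congr_of_eventuallyEq (Eventually.of_forall key)

theorem isUnitaryGroupOf_unitaryGroup (n : ℕ) :
    IsUnitaryGroupOf (harmonicOscillator n) (unitaryGroup n) where
  map_zero := LinearIsometryEquiv.ext unitaryGroup_zero
  map_add := unitaryGroup_add
  strongly_continuous := continuous_unitaryGroup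
  generator u v := by
    refine ⟨hasDerivAt_unitaryGroup, fun h ↦ (mem_graph_iff_pairing u v).2 fun φ ↦ ?_⟩
    have h1 := hasDerivAt_pairing_left h (toL2 φ)
    have h2 := hasDerivAt_pairing_schwartzGroup u 0 φ
    simp only [← pairing_unitaryGroup, schwartzGroup_zero] at h2
    have h3 := h1.unique h2
    rw [map_smul, _root_.smul_apply, smul_eq_mul] at h3
    exact (mul_left_cancel₀ Complex.I_ne_zero h3).symm

namespace IsUnitaryGroupOf

variable {H : L2 n →ₗ.[ℂ] L2 n} {U : ℝ → (L2 n ≃ₗᵢ[ℂ] L2 n)}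

theorem apply_zero (hU : IsUnitaryGroupOf H U) (u : L2 n) : U 0 u = u := by
  rw [hU.map_zero]; rfl

theorem map_mem_graph (hU : IsUnitaryGroupOf H U) {u v : L2 n} (h : (u, v) ∈ H.graph) (t : ℝ) :
    (U t u, U t v) ∈ H.graph := by
  rw [hU.generator] at h ⊢
  have h1 := (ContinuousLinearMap.restrictScalars ℝ
    (U t).toContinuousLinearEquiv.toContinuousLinearMap).hasFDerivAt.comp_hasDerivAt 0 h
  have e : (fun s ↦ U s (U t u)) = fun s ↦ U t (U s u) := by
    funext s
    rw [← hU.map_add, ← hU.map_add, add_comm]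
  rw [e, ← map_smul]
  exact h1

theorem hasDerivAt (hU : IsUnitaryGroupOf H U) {u v : L2 n} (h : (u, v) ∈ H.graph) (t : ℝ) :
    HasDerivAt (fun t ↦ U t u) (Complex.I • U t v) t := by
  have h1 := (hU.generator _ _).1 (hU.map_mem_graph h t)
  rw [← sub_self t] at h1
  refine (h1.comp_sub_const t t).congr_of_eventuallyEq (Eventually.of_forall fun s ↦ ?_)
  simp only [← hU.map_add, sub_add_cancel]

/-- `i H` is skew-symmetric on its domain. -/
theorem inner_add_inner_eq_zero (hU : IsUnitaryGroupOf H U) {u v : L2 n}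
    (h : (u, v) ∈ H.graph) :
    inner ℂ u (Complex.I • v) + inner ℂ (Complex.I • v) u = 0 := by
  have h1 := (hU.generator _ _).1 h
  have h2 := h1.inner ℂ h1
  simp only [LinearIsometryEquiv.inner_map_map, hU.apply_zero] at h2
  exact h2.unique (hasDerivAt_const _ _)

/-- A group is determined by its generator, if the latter is densely defined. -/
theorem unique (hU : IsUnitaryGroupOf H U) {V : ℝ → (L2 n ≃ₗᵢ[ℂ] L2 n)}
    (hV : IsUnitaryGroupOf H V) (hH : Dense (H.domain : Set (L2 n))) : U = V := by
  funext t
  refine LinearIsometryEquiv.ext fun u ↦ ?_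
  refine hH.induction (fun u hu ↦ ?_)
    (isClosed_eq (U t).continuous (V t).continuous) u
  have hg : (u, H ⟨u, hu⟩) ∈ H.graph := H.mem_graph ⟨u, hu⟩
  rw [← sub_eq_zero]
  refine eq_zero_of_inner_deriv_eq_zero (s := Set.univ) (t₀ := 0) convex_univ
    (w := fun t ↦ U t u - V t u) (w' := fun t ↦ Complex.I • (U t (H ⟨u, hu⟩) - V t (H ⟨u, hu⟩)))
    (fun t _ ↦ ?_) (fun t _ ↦ ?_) trivial ?_ trivial
  · rw [smul_sub]
    exact (hU.hasDerivAt hg t).sub (hV.hasDerivAt hg t)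
  · exact hU.inner_add_inner_eq_zero
      (H.graph.sub_mem (hU.map_mem_graph hg t) (hV.map_mem_graph hg t))
  · simp only [hU.apply_zero, hV.apply_zero, sub_self]

end IsUnitaryGroupOf

theorem dense_domain_harmonicOscillator (n : ℕ) :
    Dense ((harmonicOscillator n).domain : Set (L2 n)) := by
  refine denseRange_toL2.mono ?_
  rintro _ ⟨φ, rfl⟩
  exact LinearPMap.mem_domain_of_mem_graph (schwartz_mem_graph n φ)

/-! ### Covariance of the Wigner transform -/

/-- The Wigner transform `(q, ξ) ↦ ∫ e^{i p·ξ} v(q + p / 2) u(q - p / 2) dp`, for which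
`(Op(f) u)(v) = f (wigner v u)`. -/
def wigner (v u : 𝓢(Config n, ℂ)) : 𝓢(Phase n, ℂ) := kernelTranspose n (tensorLeft u v)

theorem weylOp_eq_wigner (f : 𝓢'(Phase n, ℂ)) (u v : 𝓢(Config n, ℂ)) :
    weylOp n f u v = f (wigner v u) := rfl

theorem wigner_apply (v u : 𝓢(Config n, ℂ)) (q ξ : Config n) :
    wigner v u (q, ξ) = ∫ p : Config n, Complex.exp (((inner ℝ p ξ : ℝ) : ℂ) * Complex.I) *
      (v (q + (1 / 2 : ℝ) • p) * u (q - (1 / 2 : ℝ) • p)) := rfl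

/-- A chirp acts on the Wigner transform by a shear in the momentum. -/
theorem wigner_chirpMul (a : ℝ) (v u : 𝓢(Config n, ℂ)) (q ξ : Config n) :
    wigner (chirpMul n a v) (chirpMul n (-a) u) (q, ξ) = wigner v u (q, ξ + a • q) := by
  rw [wigner_apply, wigner_apply]
  congr 1 with p
  have h : Complex.exp (((inner ℝ p ξ : ℝ) : ℂ) * Complex.I) *
      (chirp n a (q + (1 / 2 : ℝ) • p) * chirp n (-a) (q - (1 / 2 : ℝ) • p)) =
      Complex.exp (((inner ℝ p (ξ + a • q) : ℝ) : ℂ) * Complex.I) := by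
    rw [chirp, chirp, ← Complex.exp_add, ← Complex.exp_add, ← add_mul, ← add_mul,
      ← Complex.ofReal_add, ← Complex.ofReal_add]
    congr 3
    rw [norm_add_sq_real, norm_sub_sq_real, inner_add_right, inner_smul_right, inner_smul_right,
      real_inner_comm p q]
    ring
  rw [chirpMul_apply, chirpMul_apply, ← h]
  ring

theorem integrable_mul_of_norm_le_one (g : 𝓢(Phase n, ℂ)) {c : Phase n → ℂ} (hc : Continuous c)
    (h : ∀ z, ‖c z‖ ≤ 1) :
    Integrable (fun z ↦ c z * g z) ((volume : Measure (Config n)).prod volume) := by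
  have : (volume : Measure (Phase n)).IsAddHaarMeasure :=
    inferInstanceAs ((volume : Measure (Config n)).prod volume).IsAddHaarMeasure
  have hg : Integrable (g : Phase n → ℂ) volume := g.integrable
  exact hg.bdd_mul hc.aestronglyMeasurable (Eventually.of_forall h)

/-- The substitution `x = q + p / 2`, `y = q - p / 2` in a double integral, where it has
Jacobian `1`. -/
theorem integral_midpoint (g : 𝓢(Phase n, ℂ)) {c : Phase n → ℂ} (hc : Continuous c)
    (h : ∀ z, ‖c z‖ ≤ 1) :
    ∫ q : Config n, ∫ p : Config n, c (q + (1 / 2 : ℝ) • p, q - (1 / 2 : ℝ) • p) *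
      g (q + (1 / 2 : ℝ) • p, q - (1 / 2 : ℝ) • p) =
    ∫ y : Config n, ∫ x : Config n, c (x, y) * g (x, y) := by
  let shear : Phase n ≃L[ℝ] Phase n := ContinuousLinearEquiv.equivOfInverse
    ((ContinuousLinearMap.fst ℝ (Config n) (Config n)
        + ContinuousLinearMap.snd ℝ (Config n) (Config n)).prod
      (ContinuousLinearMap.snd ℝ (Config n) (Config n)))
    ((ContinuousLinearMap.fst ℝ (Config n) (Config n)
        - ContinuousLinearMap.snd ℝ (Config n) (Config n)).prod
      (ContinuousLinearMap.snd ℝ (Config n) (Config n)))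
    (fun z ↦ by simp) (fun z ↦ by simp)
  have h1 := integrable_mul_of_norm_le_one
    (compCLMOfContinuousLinearEquiv ℂ (midpointChange n) g) (c := c ∘ midpointChange n)
    (hc.comp (midpointChange n).continuous) fun z ↦ h _
  have h2 := integrable_mul_of_norm_le_one
    (compCLMOfContinuousLinearEquiv ℂ shear g) (c := c ∘ shear)
    (hc.comp shear.continuous) fun z ↦ h _
  calc _ = ∫ p : Config n, ∫ q : Config n, c (q + (1 / 2 : ℝ) • p, q - (1 / 2 : ℝ) • p) *
      g (q + (1 / 2 : ℝ) • p, q - (1 / 2 : ℝ) • p) := integral_integral_swap h1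
    _ = ∫ p : Config n, ∫ y : Config n, c (p + y, y) * g (p + y, y) := by
      congr 1 with p
      rw [← integral_sub_right_eq_self (fun y ↦ c (p + y, y) * g (p + y, y)) ((1 / 2 : ℝ) • p)]
      congr 1 with q
      have e : p + (q - (1 / 2 : ℝ) • p) = q + (1 / 2 : ℝ) • p := by module
      rw [e]
    _ = ∫ y : Config n, ∫ p : Config n, c (p + y, y) * g (p + y, y) := integral_integral_swap h2
    _ = _ := by
      congr 1 with y
      exact integral_add_right_eq_self (fun x ↦ c (x, y) * g (x, y)) y

/-- The restriction of a Schwartz function on phase space to a fixed momentum. -/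
def positionSlice (ξ : Config n) : 𝓢(Phase n, ℂ) →L[ℂ] 𝓢(Config n, ℂ) :=
  compCLMOfAntilipschitz ℂ (g := fun q : Config n ↦ ((q, ξ) : Phase n)) (K := 1)
    (by
      have h : (fun q : Config n ↦ ((q, ξ) : Phase n)) =
          (ContinuousLinearMap.inl ℝ (Config n) (Config n) : Config n → Phase n) +
            fun _ ↦ (0, ξ) := by
        funext q; simp
      rw [h]
      exact (ContinuousLinearMap.hasTemperateGrowth _).add (Function.HasTemperateGrowth.const _))
    (AntilipschitzWith.of_le_mul_dist fun x y ↦ by simp [Prod.dist_eq])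

theorem positionSlice_apply (ξ : Config n) (g : 𝓢(Phase n, ℂ)) (q : Config n) :
    positionSlice ξ g q = g (q, ξ) := rfl

/-- The Fourier transform of the Wigner transform in the position variable. -/
theorem fourier_positionSlice_wigner (v u : 𝓢(Config n, ℂ)) (ξ η : Config n) :
    𝓕 (positionSlice ξ (wigner v u)) η =
      𝓕 v ((1 / 2 : ℝ) • η - (2 * Real.pi)⁻¹ • ξ) *
        𝓕 u ((1 / 2 : ℝ) • η + (2 * Real.pi)⁻¹ • ξ) := by
  have hpi := Real.pi_ne_zero
  set k₁ := (1 / 2 : ℝ) • η - (2 * Real.pi)⁻¹ • ξ with hk₁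
  set k₂ := (1 / 2 : ℝ) • η + (2 * Real.pi)⁻¹ • ξ with hk₂
  let c : Phase n → ℂ := fun z ↦ Complex.exp
    ((((-2 * Real.pi * inner ℝ z.1 k₁) + (-2 * Real.pi * inner ℝ z.2 k₂) : ℝ) : ℂ) * Complex.I)
  have hc : Continuous c := by fun_prop
  have key := integral_midpoint (tensorLeft u v) hc
    fun z ↦ (Complex.norm_exp_ofReal_mul_I _).le
  have hr : 𝓕 v k₁ * 𝓕 u k₂ =
      ∫ y : Config n, ∫ x : Config n, c (x, y) * tensorLeft u v (x, y) := by
    rw [fourier_coe, fourier_coe, Real.fourier_eq', Real.fourier_eq', ← integral_const_mul]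
    congr 1 with y
    rw [← integral_mul_const]
    congr 1 with x
    simp only [c, tensorLeft_apply, Complex.ofReal_add, add_mul, Complex.exp_add, smul_eq_mul]
    ring
  rw [hr, ← key, fourier_coe, Real.fourier_eq']
  congr 1 with q
  rw [positionSlice_apply, wigner_apply, smul_eq_mul, ← integral_const_mul]
  congr 1 with p
  rw [tensorLeft_apply, ← mul_assoc, ← Complex.exp_add, ← add_mul, ← Complex.ofReal_add]
  congr 4
  simp only [hk₁, hk₂, inner_add_left, inner_sub_left, inner_add_right, inner_sub_right,
    inner_smul_left, inner_smul_right]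
  simp
  field_simp
  ring

theorem fourier_freeProp (b : ℝ) (φ : 𝓢(Config n, ℂ)) :
    𝓕 (freeProp n b φ) = chirpMul n ((2 * Real.pi) ^ 2 * b) (𝓕 φ) := by
  rw [freeProp_apply, fourier_fourierInv_eq]

/-- The free propagator acts on the Wigner transform by a shear in the position. -/
theorem wigner_freeProp (b : ℝ) (v u : 𝓢(Config n, ℂ)) (q ξ : Config n) :
    wigner (freeProp n b v) (freeProp n (-b) u) (q, ξ) = wigner v u (q - b • ξ, ξ) := by
  have hpi := Real.pi_ne_zero
  have hinv (g : 𝓢(Config n, ℂ)) (x : Config n) :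
      g x = ∫ η : Config n, Complex.exp (((2 * Real.pi * inner ℝ η x : ℝ) : ℂ) * Complex.I) •
        𝓕 g η := by
    rw [← Real.fourierInv_eq', ← fourierInv_coe, fourierInv_fourier_eq]
  rw [← positionSlice_apply, ← positionSlice_apply, hinv, hinv (positionSlice ξ (wigner v u))]
  congr 1 with η
  rw [fourier_positionSlice_wigner, fourier_positionSlice_wigner, fourier_freeProp,
    fourier_freeProp, chirpMul_apply, chirpMul_apply]
  have h : Complex.exp (((2 * Real.pi * inner ℝ η q : ℝ) : ℂ) * Complex.I) *
      (chirp n ((2 * Real.pi) ^ 2 * b) ((1 / 2 : ℝ) • η - (2 * Real.pi)⁻¹ • ξ) *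
        chirp n ((2 * Real.pi) ^ 2 * -b) ((1 / 2 : ℝ) • η + (2 * Real.pi)⁻¹ • ξ)) =
      Complex.exp (((2 * Real.pi * inner ℝ η (q - b • ξ) : ℝ) : ℂ) * Complex.I) := by
    rw [chirp, chirp, ← Complex.exp_add, ← Complex.exp_add, ← add_mul, ← add_mul,
      ← Complex.ofReal_add, ← Complex.ofReal_add]
    congr 3
    rw [norm_add_sq_real, norm_sub_sq_real, inner_sub_right, inner_smul_right, inner_smul_right,
      real_inner_smul_left]
    field_simp
    ring
  rw [smul_eq_mul, smul_eq_mul, ← h]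
  ring

theorem wigner_shortProp {t : ℝ} (ht : |t| < Real.pi) (v u : 𝓢(Config n, ℂ)) :
    wigner (shortProp n t v) (shortProp n (-t) u) =
      compCLMOfContinuousLinearEquiv ℂ (flow n (-t)) (wigner v u) := by
  have h1 := tan_half_mul_sin ht
  have h2 := tan_half_mul_one_add_cos ht
  ext ⟨q, ξ⟩
  rw [compCLMOfContinuousLinearEquiv_apply, Function.comp_apply, flow_apply, shortProp_apply,
    shortProp_apply, neg_div, Real.tan_neg, Real.sin_neg, Real.cos_neg, wigner_chirpMul,
    wigner_freeProp, wigner_chirpMul]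
  congr 2
  · linear_combination (norm := module) (-h1) • q
  · linear_combination (norm := module) (h2 - Real.tan (t / 2) * h1) • q - h1 • ξ

theorem flow_add (s t : ℝ) (z : Phase n) : flow n (s + t) z = flow n s (flow n t z) := by
  obtain ⟨x, ξ⟩ := z
  simp only [flow_apply, Real.cos_add, Real.sin_add]
  congr 1 <;> module

/-- Covariance of the Wigner transform: the quantum evolution of `v` and `u` amounts to the
classical evolution of the phase space. -/
theorem wigner_schwartzGroup (t : ℝ) (v u : 𝓢(Config n, ℂ)) :
    wigner (schwartzGroup n t v) (schwartzGroup n (-t) u) =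
      compCLMOfContinuousLinearEquiv ℂ (flow n (-t)) (wigner v u) := by
  revert v u
  refine real_induction_add (P := fun t ↦ ∀ v u : 𝓢(Config n, ℂ),
    wigner (schwartzGroup n t v) (schwartzGroup n (-t) u) =
      compCLMOfContinuousLinearEquiv ℂ (flow n (-t)) (wigner v u))
    (fun t ht v u ↦ ?_) (fun s t hs ht v u ↦ ?_) t
  · rw [schwartzGroup_of_abs_le ht, schwartzGroup_of_abs_le (by rwa [abs_neg]),
      wigner_shortProp (by have := Real.pi_gt_three; linarith)]
  · rw [neg_add, schwartzGroup_add, schwartzGroup_add, hs, ht]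
    ext z
    simp only [compCLMOfContinuousLinearEquiv_apply, Function.comp_apply]
    rw [← flow_add, add_comm]

/-! ### The infinitesimal classical flow -/

/-- The Hamiltonian vector field `(x, ξ) ↦ (ξ, -x)` of `h₀`. -/
def hamiltonField (n : ℕ) : Phase n →L[ℝ] Phase n :=
  (ContinuousLinearMap.snd ℝ (Config n) (Config n)).prod
    (-ContinuousLinearMap.fst ℝ (Config n) (Config n))

theorem hamiltonField_apply (q ξ : Config n) : hamiltonField n (q, ξ) = (ξ, -q) := rfl

theorem flow_eq (t : ℝ) (z : Phase n) :
    flow n t z = Real.cos t • z + Real.sin t • hamiltonField n z := by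
  obtain ⟨q, ξ⟩ := z
  rw [flow_apply, hamiltonField_apply]
  ext i <;> simp
  ring

theorem hasDerivAt_flow (t : ℝ) (z : Phase n) :
    HasDerivAt (fun t ↦ flow n t z) (hamiltonField n (flow n t z)) t := by
  have h := ((Real.hasDerivAt_cos t).smul_const z).add
    ((Real.hasDerivAt_sin t).smul_const (hamiltonField n z))
  have e : (fun t ↦ flow n t z) =
      (fun t ↦ Real.cos t • z) + fun t ↦ Real.sin t • hamiltonField n z :=
    funext fun t ↦ flow_eq t z
  have hJ : hamiltonField n (hamiltonField n z) = -z := by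
    obtain ⟨q, ξ⟩ := z
    simp [hamiltonField_apply]
  rw [e]
  refine h.congr_deriv ?_
  rw [flow_eq, map_add, map_smul, map_smul, hJ]
  module

theorem norm_flow_le (t : ℝ) (z : Phase n) : ‖flow n t z‖ ≤ 2 * ‖z‖ := by
  have hJ : ‖hamiltonField n z‖ ≤ ‖z‖ := by
    obtain ⟨q, ξ⟩ := z
    rw [hamiltonField_apply, Prod.norm_def, Prod.norm_def, norm_neg, max_comm]
  calc ‖flow n t z‖ ≤ ‖Real.cos t • z‖ + ‖Real.sin t • hamiltonField n z‖ := by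
        rw [flow_eq]; exact norm_add_le _ _
    _ ≤ 1 * ‖z‖ + 1 * ‖z‖ := by
        rw [norm_smul, norm_smul]
        gcongr
        · exact Real.abs_cos_le_one t
        · exact Real.abs_sin_le_one t
    _ = 2 * ‖z‖ := by ring

theorem flow_zero (z : Phase n) : flow n 0 z = z := by
  simp [flow_eq]

theorem norm_le_flow (t : ℝ) (z : Phase n) : ‖z‖ ≤ 2 * ‖flow n t z‖ := by
  have h := norm_flow_le (-t) (flow n t z)
  rwa [← flow_add, neg_add_cancel, flow_zero] at h

section

variable {V : Type} [NormedAddCommGroup V] [NormedSpace ℝ V]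

/-- Composition with the flow, on vector-valued Schwartz functions. -/
def compFlow (t : ℝ) : 𝓢(Phase n, V) →L[ℝ] 𝓢(Phase n, V) :=
  compCLMOfContinuousLinearEquiv ℝ (flow n t)

/-- The derivative along the Hamiltonian vector field. -/
def hamiltonDeriv : 𝓢(Phase n, V) →L[ℝ] 𝓢(Phase n, V) :=
  bilinLeftCLM (ContinuousLinearMap.id ℝ (Phase n →L[ℝ] V))
    (hamiltonField n).hasTemperateGrowth ∘L fderivCLM ℝ (Phase n) V

theorem hamiltonDeriv_apply (g : 𝓢(Phase n, V)) (z : Phase n) :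
    hamiltonDeriv g z = fderiv ℝ g z (hamiltonField n z) := rfl

theorem hasDerivAt_compFlow (g : 𝓢(Phase n, V)) (t : ℝ) (z : Phase n) :
    HasDerivAt (fun t ↦ g (flow n t z)) (hamiltonDeriv g (flow n t z)) t :=
  (g.hasFDerivAt _).comp_hasDerivAt t (hasDerivAt_flow t z)

/-- The second-order Taylor remainder of `t ↦ g ∘ φ_t`. -/
def flowRemainder (t : ℝ) (g : 𝓢(Phase n, V)) : 𝓢(Phase n, V) :=
  compFlow t g - g - t • hamiltonDeriv g

theorem flowRemainder_apply (t : ℝ) (g : 𝓢(Phase n, V)) (z : Phase n) :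
    flowRemainder t g z = g (flow n t z) - g z - t • hamiltonDeriv g z := rfl

/-- Taylor's formula of order two along the flow. -/
theorem pow_mul_norm_flowRemainder_le (k : ℕ) (t : ℝ) (g : 𝓢(Phase n, V)) (z : Phase n) :
    ‖z‖ ^ k * ‖flowRemainder t g z‖ ≤
      2 ^ k * SchwartzMap.seminorm ℝ k 0 (hamiltonDeriv (hamiltonDeriv g)) * t ^ 2 := by
  set C := 2 ^ k * SchwartzMap.seminorm ℝ k 0 (hamiltonDeriv (hamiltonDeriv g)) with hC
  -- weighting `g` by the constant `‖z‖ ^ k` turns the claim into a bound without weights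
  have hb (s : ℝ) : ‖‖z‖ ^ k • hamiltonDeriv (hamiltonDeriv g) (flow n s z)‖ ≤ C := by
    rw [norm_smul, norm_pow, norm_norm]
    calc ‖z‖ ^ k * ‖hamiltonDeriv (hamiltonDeriv g) (flow n s z)‖
        ≤ (2 * ‖flow n s z‖) ^ k * ‖hamiltonDeriv (hamiltonDeriv g) (flow n s z)‖ := by
          gcongr; exact norm_le_flow s z
      _ = 2 ^ k * (‖flow n s z‖ ^ k * ‖hamiltonDeriv (hamiltonDeriv g) (flow n s z)‖) := by
          rw [mul_pow]; ring
      _ ≤ C := by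
          rw [hC]; gcongr; exact norm_pow_mul_le_seminorm ℝ _ k _
  have h1 (s : ℝ) : ‖‖z‖ ^ k • hamiltonDeriv g (flow n s z) - ‖z‖ ^ k • hamiltonDeriv g z‖ ≤
      C * |s| := by
    have h := convex_univ.norm_image_sub_le_of_norm_hasDerivWithin_le
      (fun r _ ↦ ((hasDerivAt_compFlow (hamiltonDeriv g) r z).const_smul
        (‖z‖ ^ k)).hasDerivWithinAt) (fun r _ ↦ hb r) (Set.mem_univ 0) (Set.mem_univ s)
    simpa [flow_zero] using h
  have hC0 : 0 ≤ C := (norm_nonneg _).trans (hb 0)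
  have hd (s : ℝ) : HasDerivAt (fun s ↦ ‖z‖ ^ k • g (flow n s z) - s • ‖z‖ ^ k • hamiltonDeriv g z)
      (‖z‖ ^ k • hamiltonDeriv g (flow n s z) - (1 : ℝ) • ‖z‖ ^ k • hamiltonDeriv g z) s :=
    ((hasDerivAt_compFlow g s z).const_smul (‖z‖ ^ k)).sub ((hasDerivAt_id s).smul_const _)
  have h2 := (convex_uIcc 0 t).norm_image_sub_le_of_norm_hasDerivWithin_le (C := C * |t|)
    (fun s _ ↦ (hd s).hasDerivWithinAt) (fun s hs ↦ ?_) Set.left_mem_uIcc Set.right_mem_uIcc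
  · have e : ‖z‖ ^ k * ‖flowRemainder t g z‖ = ‖‖z‖ ^ k • flowRemainder t g z‖ := by
      rw [norm_smul, norm_pow, norm_norm]
    rw [e, flowRemainder_apply]
    simp only [flow_zero, zero_smul, sub_zero, Real.norm_eq_abs] at h2
    calc _ = ‖‖z‖ ^ k • g (flow n t z) - t • ‖z‖ ^ k • hamiltonDeriv g z - ‖z‖ ^ k • g z‖ := by
          congr 1; module
      _ ≤ C * |t| * |t| := h2
      _ = C * t ^ 2 := by rw [mul_assoc, abs_mul_abs_self, sq]
  · rw [one_smul]
    refine (h1 s).trans (mul_le_mul_of_nonneg_left ?_ hC0)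
    have := Set.abs_sub_left_of_mem_uIcc hs
    rwa [sub_zero, sub_zero] at this

/-- Precomposition of the values of an operator-valued Schwartz function with the vector field. -/
def precompField : 𝓢(Phase n, Phase n →L[ℝ] V) →L[ℝ] 𝓢(Phase n, Phase n →L[ℝ] V) :=
  postcompCLM ((ContinuousLinearMap.compL ℝ (Phase n) (Phase n) V).flip (hamiltonField n))

theorem precompField_apply (G : 𝓢(Phase n, Phase n →L[ℝ] V)) (z w : Phase n) :
    precompField G z w = G z (hamiltonField n w) := rfl

theorem fderivCLM_hamiltonDeriv (g : 𝓢(Phase n, V)) :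
    fderivCLM ℝ (Phase n) V (hamiltonDeriv g) =
      hamiltonDeriv (fderivCLM ℝ (Phase n) V g) + precompField (fderivCLM ℝ (Phase n) V g) := by
  refine SchwartzMap.ext fun z ↦ ContinuousLinearMap.ext fun w ↦ ?_
  have h1 : HasFDerivAt (hamiltonDeriv g) _ z :=
    ((fderivCLM ℝ (Phase n) V g).hasFDerivAt z).clm_apply (hamiltonField n).hasFDerivAt
  have hs : IsSymmSndFDerivAt ℝ g z :=
    (g.smooth ⊤).contDiffAt.isSymmSndFDerivAt
      (by simpa using WithTop.coe_le_coe.2 (le_top : (2 : ℕ∞) ≤ ⊤))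
  rw [fderivCLM_apply, h1.fderiv]
  simp only [_root_.add_apply, precompField_apply, hamiltonDeriv_apply, fderivCLM_apply,
    ContinuousLinearMap.flip_apply, ContinuousLinearMap.comp_apply]
  rw [add_comm]
  congr 1
  exact hs _ _

theorem fderivCLM_compFlow (t : ℝ) (g : 𝓢(Phase n, V)) :
    fderivCLM ℝ (Phase n) V (compFlow t g) =
      Real.cos t • compFlow t (fderivCLM ℝ (Phase n) V g) +
        Real.sin t • compFlow t (precompField (fderivCLM ℝ (Phase n) V g)) := by
  refine SchwartzMap.ext fun z ↦ ContinuousLinearMap.ext fun w ↦ ?_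
  have h1 : HasFDerivAt (compFlow t g) _ z :=
    (g.hasFDerivAt _).comp z (flow n t).hasFDerivAt
  rw [fderivCLM_apply, h1.fderiv, ContinuousLinearMap.comp_apply]
  change fderiv ℝ g (flow n t z) (flow n t w) = _
  rw [flow_eq t w, map_add, map_smul, map_smul]
  rfl

/-- The derivative of the remainder is a remainder of the derivative, up to terms that are `O(t²)`
by lower-order information: `φ_t' = cos t + sin t · J` with the field `J`. -/
theorem fderivCLM_flowRemainder (t : ℝ) (g : 𝓢(Phase n, V)) :
    fderivCLM ℝ (Phase n) V (flowRemainder t g) =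
      flowRemainder t (fderivCLM ℝ (Phase n) V g) +
        (Real.cos t - 1) • compFlow t (fderivCLM ℝ (Phase n) V g) +
        (Real.sin t • (compFlow t (precompField (fderivCLM ℝ (Phase n) V g)) -
          precompField (fderivCLM ℝ (Phase n) V g)) +
        (Real.sin t - t) • precompField (fderivCLM ℝ (Phase n) V g)) := by
  simp only [flowRemainder, map_sub, map_smul, fderivCLM_compFlow, fderivCLM_hamiltonDeriv]
  module

end

/-- The Taylor remainder of the flow is `O(t²)` in every Schwartz seminorm. -/
theorem seminorm_flowRemainder_le (k m : ℕ) : ∀ (V : Type) [NormedAddCommGroup V]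
    [NormedSpace ℝ V] (g : 𝓢(Phase n, V)), ∃ C, 0 ≤ C ∧ ∀ t : ℝ, |t| ≤ 1 →
      SchwartzMap.seminorm ℝ k m (flowRemainder t g) ≤ C * t ^ 2 := by
  induction m with
  | zero =>
    intro V _ _ g
    refine ⟨2 ^ k * SchwartzMap.seminorm ℝ k 0 (hamiltonDeriv (hamiltonDeriv g)), by positivity,
      fun t _ ↦ SchwartzMap.seminorm_le_bound ℝ k 0 _ (by positivity) fun z ↦ ?_⟩
    rw [norm_iteratedFDeriv_zero]
    exact pow_mul_norm_flowRemainder_le k t g z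
  | succ m ih =>
    intro V _ _ g
    let G := fderivCLM ℝ (Phase n) V g
    let p : Seminorm ℝ 𝓢(Phase n, Phase n →L[ℝ] V) := SchwartzMap.seminorm ℝ k m
    obtain ⟨C₁, hC₁, h1⟩ := ih (Phase n →L[ℝ] V) G
    obtain ⟨C₂, hC₂, h2⟩ := ih (Phase n →L[ℝ] V) (precompField G)
    -- first-order consequence of the second-order expansion
    have hdiff (F : 𝓢(Phase n, Phase n →L[ℝ] V)) {C : ℝ} (hC : 0 ≤ C)
        (h : ∀ t : ℝ, |t| ≤ 1 → p (flowRemainder t F) ≤ C * t ^ 2) {t : ℝ} (ht : |t| ≤ 1) :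
        p (compFlow t F - F) ≤ (C + p (hamiltonDeriv F)) * |t| := by
      have e : compFlow t F - F = flowRemainder t F + t • hamiltonDeriv F := by
        rw [flowRemainder, sub_add_cancel]
      calc p (compFlow t F - F) ≤ p (flowRemainder t F) + p (t • hamiltonDeriv F) := by
            rw [e]; exact map_add_le_add p _ _
        _ ≤ C * t ^ 2 + |t| * p (hamiltonDeriv F) := by
            rw [map_smul_eq_mul, Real.norm_eq_abs]; gcongr; exact h t ht
        _ ≤ C * |t| + |t| * p (hamiltonDeriv F) := by
            gcongr
            rw [← sq_abs]
            nlinarith [abs_nonneg t]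
        _ = _ := by ring
    refine ⟨C₁ + (C₁ + p (hamiltonDeriv G) + p G) + (C₂ + p (hamiltonDeriv (precompField G)))
      + p (precompField G), by positivity, fun t ht ↦ ?_⟩
    have hp : SchwartzMap.seminorm ℝ k (m + 1) (flowRemainder t g) ≤
        p (fderivCLM ℝ (Phase n) V (flowRemainder t g)) := by
      refine SchwartzMap.seminorm_le_bound ℝ k (m + 1) _ (by positivity) fun z ↦ ?_
      rw [← norm_iteratedFDeriv_fderiv]
      exact SchwartzMap.le_seminorm ℝ k m (fderivCLM ℝ (Phase n) V (flowRemainder t g)) z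
    have hcos : |Real.cos t - 1| ≤ t ^ 2 := by
      have := Real.one_sub_sq_div_two_le_cos (x := t)
      rw [abs_sub_comm, abs_of_nonneg (by linarith [Real.cos_le_one t])]
      nlinarith [sq_nonneg t]
    have hsin : |Real.sin t - t| ≤ t ^ 2 := by
      have h := abs_le.1 (Real.sin_bound ht)
      have h3 : |t ^ 3| ≤ t ^ 2 := by
        rw [pow_succ, abs_mul, abs_of_nonneg (sq_nonneg t)]
        exact mul_le_of_le_one_right (sq_nonneg t) ht
      have h4 : |t| ^ 5 ≤ t ^ 2 := by
        rw [← sq_abs t]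
        exact pow_le_pow_of_le_one (abs_nonneg t) ht (by norm_num)
      have h5 := abs_le.1 h3
      exact abs_le.2 ⟨by linarith [sq_nonneg t], by linarith [sq_nonneg t]⟩
    have hsin1 : |Real.sin t| ≤ |t| := Real.abs_sin_le_abs
    have hG : p (compFlow t G) ≤ C₁ + p (hamiltonDeriv G) + p G := by
      have e : compFlow t G = (compFlow t G - G) + G := by rw [sub_add_cancel]
      rw [e]
      refine (map_add_le_add p _ _).trans ?_
      gcongr
      exact (hdiff G hC₁ h1 ht).trans (mul_le_of_le_one_right (by positivity) ht)
    rw [fderivCLM_flowRemainder] at hp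
    refine hp.trans ?_
    calc _ ≤ p (flowRemainder t G) + p ((Real.cos t - 1) • compFlow t G) +
          (p (Real.sin t • (compFlow t (precompField G) - precompField G)) +
          p ((Real.sin t - t) • precompField G)) :=
          (map_add_le_add p _ _).trans (add_le_add (map_add_le_add p _ _) (map_add_le_add p _ _))
      _ ≤ C₁ * t ^ 2 + t ^ 2 * (C₁ + p (hamiltonDeriv G) + p G) +
          (|t| * ((C₂ + p (hamiltonDeriv (precompField G))) * |t|) +
            t ^ 2 * p (precompField G)) := by
          simp only [map_smul_eq_mul, Real.norm_eq_abs]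
          gcongr
          · exact h1 t ht
          · exact hdiff (precompField G) hC₂ h2 ht
      _ = _ := by
          rw [← sq_abs t]; ring

/-- A tempered constant of motion annihilates the derivatives along the flow. -/
theorem IsTemperedConstantOfMotion.apply_hamiltonDeriv {f : 𝓢'(Phase n, ℂ)}
    (hf : IsTemperedConstantOfMotion n f) (g : 𝓢(Phase n, ℂ)) : f (hamiltonDeriv g) = 0 := by
  have hlim : Tendsto (fun t : ℝ ↦ t⁻¹ • flowRemainder t g) (𝓝[≠] 0) (𝓝 0) := by
    rw [(schwartz_withSeminorms ℝ (Phase n) ℂ).tendsto_nhds]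
    rintro ⟨k, m⟩ ε hε
    obtain ⟨C, hC, h⟩ := seminorm_flowRemainder_le k m ℂ g
    have h0 : Tendsto (fun t : ℝ ↦ C * |t|) (𝓝[≠] 0) (𝓝 0) := by
      have : Continuous fun t : ℝ ↦ C * |t| := by fun_prop
      simpa using (this.tendsto 0).mono_left nhdsWithin_le_nhds
    have h1 : ∀ᶠ t : ℝ in 𝓝[≠] 0, |t| ≤ 1 := by
      refine nhdsWithin_le_nhds ?_
      filter_upwards [Metric.ball_mem_nhds (0 : ℝ) one_pos] with t ht
      simpa using (Metric.mem_ball.1 ht).le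
    filter_upwards [h0.eventually_lt_const hε, h1, self_mem_nhdsWithin] with t ht ht1 ht0
    have ht0' : 0 < |t| := abs_pos.2 ht0
    rw [sub_zero, map_smul_eq_mul, norm_inv, Real.norm_eq_abs]
    refine lt_of_le_of_lt ?_ ht
    rw [inv_mul_le_iff₀ ht0']
    refine (h t ht1).trans_eq ?_
    rw [← sq_abs]; ring
  have h1 : Tendsto (fun t : ℝ ↦ f (t⁻¹ • flowRemainder t g)) (𝓝[≠] 0) (𝓝 (f 0)) :=
    (f.continuous.tendsto 0).comp hlim
  have h2 : ∀ᶠ t : ℝ in 𝓝[≠] 0, f (t⁻¹ • flowRemainder t g) = -f (hamiltonDeriv g) := by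
    filter_upwards [self_mem_nhdsWithin] with t ht
    have e : t⁻¹ • flowRemainder t g = ((t⁻¹ : ℝ) : ℂ) • (compFlow t g - g) - hamiltonDeriv g := by
      ext z
      simp [flowRemainder, smul_sub, smul_smul, inv_mul_cancel₀ (show t ≠ 0 from ht)]
    have hc : f (compFlow t g) = f g := DFunLike.congr_fun (hf t) g
    rw [e, map_sub, map_smul, map_sub, hc, sub_self, smul_zero, zero_sub]
  have h3 := tendsto_nhds_unique (h1.congr' h2) tendsto_const_nhds
  rw [map_zero] at h3
  exact neg_eq_zero.1 h3.symm

/-! ### The Moyal identity for the oscillator -/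

/-- `wigner` as a linear map in its first argument. -/
def wignerLeft (u : 𝓢(Config n, ℂ)) : 𝓢(Config n, ℂ) →L[ℂ] 𝓢(Phase n, ℂ) :=
  kernelTranspose n ∘L tensorLeft u

theorem wignerLeft_apply (v u : 𝓢(Config n, ℂ)) : wignerLeft u v = wigner v u := rfl

/-- `wigner` as a linear map in its second argument. -/
def wignerRight (v : 𝓢(Config n, ℂ)) : 𝓢(Config n, ℂ) →L[ℂ] 𝓢(Phase n, ℂ) :=
  kernelTranspose n ∘L swapVariables n ∘L tensorLeft v

theorem wignerRight_apply (v u : 𝓢(Config n, ℂ)) : wignerRight v u = wigner v u := by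
  rw [wigner, tensorLeft_eq_swap]; rfl

/-- The function `(q, p) ↦ v(q + p / 2) u(q - p / 2)`. -/
def midpointTensor (v u : 𝓢(Config n, ℂ)) : 𝓢(Phase n, ℂ) :=
  compCLMOfContinuousLinearEquiv ℂ (midpointChange n) (tensorLeft u v)

theorem midpointTensor_apply (v u : 𝓢(Config n, ℂ)) (q p : Config n) :
    midpointTensor v u (q, p) = v (q + (1 / 2 : ℝ) • p) * u (q - (1 / 2 : ℝ) • p) := rfl

theorem wigner_eq_partialFourierFun (v u : 𝓢(Config n, ℂ)) (z : Phase n) :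
    wigner v u z = partialFourierFun (midpointTensor v u) z := rfl

theorem fderiv_midpointTensor (v u : 𝓢(Config n, ℂ)) (q p : Config n) (w : Phase n) :
    fderiv ℝ (midpointTensor v u) (q, p) w =
      midpointTensor (∂_{w.1 + (1 / 2 : ℝ) • w.2} v) u (q, p) +
        midpointTensor v (∂_{w.1 - (1 / 2 : ℝ) • w.2} u) (q, p) := by
  have h1 : HasFDerivAt (fun z : Phase n ↦ z.1 + (1 / 2 : ℝ) • z.2)
      (ContinuousLinearMap.fst ℝ (Config n) (Config n) +
        (1 / 2 : ℝ) • ContinuousLinearMap.snd ℝ (Config n) (Config n)) (q, p) :=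
    hasFDerivAt_fst.add (hasFDerivAt_snd.const_smul (1 / 2 : ℝ))
  have h2 : HasFDerivAt (fun z : Phase n ↦ z.1 - (1 / 2 : ℝ) • z.2)
      (ContinuousLinearMap.fst ℝ (Config n) (Config n) -
        (1 / 2 : ℝ) • ContinuousLinearMap.snd ℝ (Config n) (Config n)) (q, p) :=
    hasFDerivAt_fst.sub (hasFDerivAt_snd.const_smul (1 / 2 : ℝ))
  have h3 := ((v.hasFDerivAt (q + (1 / 2 : ℝ) • p)).comp (q, p) h1).mul
    ((u.hasFDerivAt (q - (1 / 2 : ℝ) • p)).comp (q, p) h2)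
  have h4 : HasFDerivAt (midpointTensor v u) _ (q, p) := h3
  rw [h4.fderiv, midpointTensor_apply, midpointTensor_apply, lineDerivOp_apply_eq_fderiv,
    lineDerivOp_apply_eq_fderiv]
  simp only [_root_.add_apply, _root_.smul_apply, ContinuousLinearMap.comp_apply,
    _root_.sub_apply, ContinuousLinearMap.coe_fst', ContinuousLinearMap.coe_snd', smul_eq_mul]
  rw [add_comm]
  simp only [Function.comp_apply]
  ring

theorem wigner_position_add (m : Config n) (v u : 𝓢(Config n, ℂ)) (q ξ : Config n) :
    wigner (position m v) u (q, ξ) + wigner v (position m u) (q, ξ) =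
      2 * ((inner ℝ q m : ℝ) : ℂ) * wigner v u (q, ξ) := by
  simp only [wigner_eq_partialFourierFun]
  rw [partialFourierFun, partialFourierFun, partialFourierFun,
    ← integral_add (integrable_phase_smul _ _ _) (integrable_phase_smul _ _ _),
    ← integral_const_mul]
  congr 1 with p
  simp only [midpointTensor_apply, position_apply, inner_add_left, inner_sub_left,
    real_inner_smul_left, smul_eq_mul]
  push_cast
  ring

theorem fderiv_wigner (v u : 𝓢(Config n, ℂ)) (q ξ : Config n) (w : Phase n) :
    fderiv ℝ (wigner v u) (q, ξ) w = ∫ p : Config n, phase p ξ •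
      (fderiv ℝ (midpointTensor v u) (q, p) (w.1, 0) +
        Complex.I • ((inner ℝ p w.2 : ℝ) • midpointTensor v u (q, p))) := by
  have h := hasFDerivAt_partialFourierFun (midpointTensor v u) (q, ξ)
  have h' : HasFDerivAt (wigner v u) _ (q, ξ) := h
  rw [h'.fderiv, partialFourierFun, ContinuousLinearMap.integral_apply
    (integrable_phase_smul (phaseDeriv n ℂ (midpointTensor v u)) q ξ)]
  rfl

theorem wigner_position_sub (m : Config n) (v u : 𝓢(Config n, ℂ)) (q ξ : Config n) :
    wigner (position m v) u (q, ξ) - wigner v (position m u) (q, ξ) =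
      -Complex.I * fderiv ℝ (wigner v u) (q, ξ) (0, m) := by
  rw [fderiv_wigner]
  simp only [wigner_eq_partialFourierFun]
  rw [partialFourierFun, partialFourierFun,
    ← integral_sub (integrable_phase_smul _ _ _) (integrable_phase_smul _ _ _),
    ← integral_const_mul]
  congr 1 with p
  have h0 : ((0, 0) : Phase n) = 0 := rfl
  simp only [midpointTensor_apply, position_apply, inner_add_left, inner_sub_left,
    real_inner_smul_left, smul_eq_mul, h0, map_zero, zero_add, Complex.real_smul]
  push_cast
  linear_combination (phase p ξ * ((inner ℝ p m : ℝ) : ℂ) *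
    (v (q + (1 / 2 : ℝ) • p) * u (q - (1 / 2 : ℝ) • p))) * Complex.I_sq

theorem wigner_momentum_add (m : Config n) (v u : 𝓢(Config n, ℂ)) (q ξ : Config n) :
    wigner (momentum m v) u (q, ξ) + wigner v (momentum m u) (q, ξ) =
      -Complex.I * fderiv ℝ (wigner v u) (q, ξ) (m, 0) := by
  rw [fderiv_wigner]
  simp only [wigner_eq_partialFourierFun]
  rw [partialFourierFun, partialFourierFun,
    ← integral_add (integrable_phase_smul _ _ _) (integrable_phase_smul _ _ _),
    ← integral_const_mul]
  congr 1 with p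
  rw [fderiv_midpointTensor]
  simp only [midpointTensor_apply, momentum_apply, _root_.smul_apply, inner_zero_right, zero_smul,
    smul_zero, add_zero, sub_zero, smul_eq_mul]
  ring

theorem wigner_momentum_sub (j : Fin n) (v u : 𝓢(Config n, ℂ)) (q ξ : Config n) :
    wigner (momentum (coordDir j) v) u (q, ξ) - wigner v (momentum (coordDir j) u) (q, ξ) =
      -2 * ((inner ℝ ξ (coordDir j) : ℝ) : ℂ) * wigner v u (q, ξ) := by
  have hj : EuclideanSpace.single j 1 = coordDir j := by simp [coordDir]
  have h := partialFourierFun_momentumDeriv (midpointTensor v u) j (q, ξ)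
  have hi : inner ℝ ξ (coordDir j) = ξ j := by
    simp [coordDir, EuclideanSpace.inner_single_right]
  have e (p : Config n) : momentumDeriv n ℂ j (midpointTensor v u) (q, p) =
      (1 / 2 * Complex.I) * (midpointTensor (momentum (coordDir j) v) u (q, p) -
        midpointTensor v (momentum (coordDir j) u) (q, p)) := by
    change fderiv ℝ (midpointTensor v u) (q, p) (0, EuclideanSpace.single j 1) = _
    rw [fderiv_midpointTensor, hj, zero_add, zero_sub, ← smul_neg, lineDerivOp_left_smul,
      lineDerivOp_left_smul, lineDerivOp_left_neg, lineDeriv_eq_momentum, lineDeriv_eq_momentum]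
    simp only [midpointTensor_apply, _root_.smul_apply, _root_.neg_apply, smul_eq_mul,
      Complex.real_smul]
    push_cast
    ring
  simp only [wigner_eq_partialFourierFun]
  rw [partialFourierFun] at h
  simp only [e] at h
  have h2 : ∫ p : Config n, phase p ξ • ((1 / 2 * Complex.I) *
      (midpointTensor (momentum (coordDir j) v) u (q, p) -
        midpointTensor v (momentum (coordDir j) u) (q, p))) =
      (1 / 2 * Complex.I) * (partialFourierFun (midpointTensor (momentum (coordDir j) v) u) (q, ξ) -
        partialFourierFun (midpointTensor v (momentum (coordDir j) u)) (q, ξ)) := by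
    rw [partialFourierFun, partialFourierFun,
      ← integral_sub (integrable_phase_smul _ _ _) (integrable_phase_smul _ _ _),
      ← integral_const_mul]
    congr 1 with p
    simp only [smul_eq_mul]
    ring
  rw [h2, ← hi, smul_eq_mul] at h
  linear_combination (-2 * Complex.I) * h +
    (partialFourierFun (midpointTensor (momentum (coordDir j) v) u) (q, ξ) -
        partialFourierFun (midpointTensor v (momentum (coordDir j) u)) (q, ξ) +
      2 * ((inner ℝ ξ (coordDir j) : ℝ) : ℂ) *
        partialFourierFun (midpointTensor v u) (q, ξ)) * Complex.I_sq

theorem wigner_position_position (m : Config n) (v u : 𝓢(Config n, ℂ)) (q ξ : Config n) :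
    wigner (position m (position m v)) u (q, ξ) - wigner v (position m (position m u)) (q, ξ) =
      -2 * Complex.I * (((inner ℝ q m : ℝ) : ℂ) * fderiv ℝ (wigner v u) (q, ξ) (0, m)) := by
  have h1 := wigner_position_add m (position m v) u q ξ
  have h2 := wigner_position_add m v (position m u) q ξ
  have h3 := wigner_position_sub m v u q ξ
  linear_combination h1 - h2 + 2 * ((inner ℝ q m : ℝ) : ℂ) * h3

theorem wigner_momentum_momentum (j : Fin n) (v u : 𝓢(Config n, ℂ)) (q ξ : Config n) :
    wigner (momentum (coordDir j) (momentum (coordDir j) v)) u (q, ξ) -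
        wigner v (momentum (coordDir j) (momentum (coordDir j) u)) (q, ξ) =
      2 * Complex.I * (((inner ℝ ξ (coordDir j) : ℝ) : ℂ) *
        fderiv ℝ (wigner v u) (q, ξ) (coordDir j, 0)) := by
  have h1 := wigner_momentum_sub j (momentum (coordDir j) v) u q ξ
  have h2 := wigner_momentum_sub j v (momentum (coordDir j) u) q ξ
  have h3 := wigner_momentum_add (coordDir j) v u q ξ
  linear_combination h1 + h2 - 2 * ((inner ℝ ξ (coordDir j) : ℝ) : ℂ) * h3

/-- The Moyal bracket with the quadratic Hamiltonian `h₀` is the Poisson bracket. -/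
theorem wigner_oscillatorSchwartz_sub (v u : 𝓢(Config n, ℂ)) :
    wigner (oscillatorSchwartz n v) u - wigner v (oscillatorSchwartz n u) =
      Complex.I • hamiltonDeriv (wigner v u) := by
  ext ⟨q, ξ⟩
  have hsplit : hamiltonField n (q, ξ) =
      ∑ j, (inner ℝ ξ (coordDir j) • (coordDir j, (0 : Config n)) -
        inner ℝ q (coordDir j) • ((0 : Config n), coordDir j)) := by
    have h (x : Config n) : ∑ j, inner ℝ x (coordDir j) • coordDir j = x := by
      conv_rhs => rw [← (EuclideanSpace.basisFun (Fin n) ℝ).sum_repr' x]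
      exact Finset.sum_congr rfl fun j _ ↦ by rw [real_inner_comm]
    rw [hamiltonField_apply, Finset.sum_sub_distrib]
    refine Prod.ext ?_ ?_
    · simpa [Prod.fst_sum] using (h ξ).symm
    · simpa [Prod.snd_sum] using (h q).symm
  rw [_root_.smul_apply, hamiltonDeriv_apply, hsplit, map_sum, _root_.sub_apply,
    ← wignerLeft_apply, ← wignerRight_apply, oscillatorSchwartz_eq, oscillatorSchwartz_eq,
    potential_eq_sum, kinetic_eq_sum, potential_eq_sum, kinetic_eq_sum]
  simp only [← smul_add, ← Finset.sum_add_distrib, map_smul, map_sum, map_add, map_sub,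
    wignerLeft_apply, wignerRight_apply, _root_.smul_apply, _root_.sum_apply, _root_.add_apply,
    smul_eq_mul, ← mul_sub, ← Finset.sum_sub_distrib, Complex.real_smul]
  rw [Finset.mul_sum, Finset.mul_sum]
  refine Finset.sum_congr rfl fun j _ ↦ ?_
  have h1 := wigner_position_position (coordDir j) v u q ξ
  have h2 := wigner_momentum_momentum j v u q ξ
  linear_combination (1 / 2 : ℂ) * h1 + (1 / 2 : ℂ) * h2

/-- Quantization maps constants of motion to operators commuting with `H₀`. -/
theorem oscillatorDistribution_comp_weylOp {f : 𝓢'(Phase n, ℂ)}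
    (hf : IsTemperedConstantOfMotion n f) :
    oscillatorDistribution n ∘L weylOp n f = weylOp n f ∘L oscillatorSchwartz n := by
  ext u v
  rw [ContinuousLinearMap.comp_apply, ContinuousLinearMap.comp_apply, oscillatorDistribution_apply,
    weylOp_eq_wigner, weylOp_eq_wigner, ← sub_eq_zero, ← map_sub, wigner_oscillatorSchwartz_sub,
    map_smul, hf.apply_hamiltonDeriv, smul_zero]

/-! ### The action on tempered distributions -/

/-- The extension of `e^{itH₀}` to tempered distributions, the transpose of its restriction to
Schwartz space. -/
def distributionGroup (n : ℕ) (t : ℝ) : 𝓢'(Config n, ℂ) →L[ℂ] 𝓢'(Config n, ℂ) :=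
  PointwiseConvergenceCLM.precomp ℂ (schwartzGroup n t : 𝓢(Config n, ℂ) →L[ℂ] 𝓢(Config n, ℂ))

theorem distributionGroup_apply (t : ℝ) (T : 𝓢'(Config n, ℂ)) (φ : 𝓢(Config n, ℂ)) :
    distributionGroup n t T φ = T (schwartzGroup n t φ) := rfl

theorem distributionGroup_coe (t : ℝ) (u : L2 n) :
    distributionGroup n t (Lp.toTemperedDistribution u) =
      Lp.toTemperedDistribution (unitaryGroup n t u) := by
  ext φ
  rw [distributionGroup_apply, toTemperedDistribution_eq_pairing, toTemperedDistribution_eq_pairing,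
    pairing_unitaryGroup]

theorem distributionGroup_comp_weylOp {f : 𝓢'(Phase n, ℂ)}
    (hf : IsTemperedConstantOfMotion n f) (t : ℝ) :
    distributionGroup n t ∘L weylOp n f ∘L
      (schwartzGroup n (-t) : 𝓢(Config n, ℂ) →L[ℂ] 𝓢(Config n, ℂ)) = weylOp n f := by
  ext u v
  change weylOp n f (schwartzGroup n (-t) u) (schwartzGroup n t v) = weylOp n f u v
  rw [weylOp_eq_wigner, weylOp_eq_wigner, wigner_schwartzGroup]
  exact DFunLike.congr_fun (hf (-t)) (wigner v u)

end HarmonicWeyl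

/-- Weyl quantization preserves constants of motion of the harmonic oscillator. The group
`U t = e^{itH₀}` exists and is unique; `S t` is its restriction to Schwartz space, and `S' t` its
continuous extension to tempered distributions (both are uniquely determined, because `𝓢` embeds
in `L²` and `L²` is dense in `𝓢'`). -/
theorem theorem3p3 (n : ℕ) :
    (∃! U : ℝ → (HarmonicWeyl.L2 n ≃ₗᵢ[ℂ] HarmonicWeyl.L2 n),
      HarmonicWeyl.IsUnitaryGroupOf (HarmonicWeyl.harmonicOscillator n) U) ∧
    ∀ U : ℝ → (HarmonicWeyl.L2 n ≃ₗᵢ[ℂ] HarmonicWeyl.L2 n),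
      HarmonicWeyl.IsUnitaryGroupOf (HarmonicWeyl.harmonicOscillator n) U →
      ∃ (S : ℝ → 𝓢(HarmonicWeyl.Config n, ℂ) →L[ℂ] 𝓢(HarmonicWeyl.Config n, ℂ))
        (S' : ℝ → 𝓢'(HarmonicWeyl.Config n, ℂ) →L[ℂ] 𝓢'(HarmonicWeyl.Config n, ℂ)),
        (∀ (t : ℝ) (φ : 𝓢(HarmonicWeyl.Config n, ℂ)),
          (S t φ).toLp 2 volume = U t (φ.toLp 2 volume)) ∧
        (∀ (t : ℝ) (u : HarmonicWeyl.L2 n),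
          S' t (Lp.toTemperedDistribution u) = Lp.toTemperedDistribution (U t u)) ∧
        ∀ f : 𝓢'(HarmonicWeyl.Phase n, ℂ), HarmonicWeyl.IsTemperedConstantOfMotion n f →
          (∀ t : ℝ, S' t ∘L HarmonicWeyl.weylOp n f ∘L S (-t) = HarmonicWeyl.weylOp n f) ∧
          HarmonicWeyl.oscillatorDistribution n ∘L HarmonicWeyl.weylOp n f =
            HarmonicWeyl.weylOp n f ∘L HarmonicWeyl.oscillatorSchwartz n := by
  have hunique : ∀ U : ℝ → (HarmonicWeyl.L2 n ≃ₗᵢ[ℂ] HarmonicWeyl.L2 n),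
      HarmonicWeyl.IsUnitaryGroupOf (HarmonicWeyl.harmonicOscillator n) U →
      U = HarmonicWeyl.unitaryGroup n := fun U hU ↦
    hU.unique (HarmonicWeyl.isUnitaryGroupOf_unitaryGroup n)
      (HarmonicWeyl.dense_domain_harmonicOscillator n)
  refine ⟨⟨HarmonicWeyl.unitaryGroup n, HarmonicWeyl.isUnitaryGroupOf_unitaryGroup n, hunique⟩,
    fun U hU ↦ ?_⟩
  obtain rfl := hunique U hU
  exact ⟨fun t ↦ HarmonicWeyl.schwartzGroup n t, HarmonicWeyl.distributionGroup n,
    fun t φ ↦ (HarmonicWeyl.unitaryGroup_toL2 t φ).symm, HarmonicWeyl.distributionGroup_coe,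
    fun f hf ↦ ⟨HarmonicWeyl.distributionGroup_comp_weylOp hf,
      HarmonicWeyl.oscillatorDistribution_comp_weylOp hf⟩⟩
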